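/- Let $\xi$ be a Gaussian process on $[0,1]^p$ with constant mean $\mu_\xi$, variance $\sigma_\xi^2$ and (measurable) correlation function $R$, $R(\bm x,\bm x)=1$. Let $\bm x_1,\dots,\bm x_n\in[0,1]^p$ be training inputs, $n=n_o+n_c$, and let $\bm x_{n+1}\in[0,1]^p$ be a potential new input. The latent responses are $Y_i'=\xi(\bm x_i)+\epsilon_i$, $i=1,\dots,n+1$, with $\epsilon_i$ i.i.d. $\mathcal N(0,\sigma_\epsilon^2)$, $\sigma_\epsilon>0$, independent of $\xi$. Let $c\in\mathbb R$ be a known limit. The data are $\mathcal Y_n=\{\bm y_o,\ \bm y_c'\ge\bm c\}$: the first $n_o$ responses are observed exactly, with value $\bm y_o\in\mathbb R^{n_o}$, and of the other $n_c$ responses, $\bm y_c'$, it is only known that each is at least $c$ (conditioning on $\bm y_o$ is given by Bayes' formula with the Gaussian likelihood of $\bm y_o$ given $\xi$). Let $Y_{n+1}=Y'_{n+1}\mathbf 1_{\{Y'_{n+1}<c\}}+c\,\mathbf 1_{\{Y'_{n+1}\ge c\}}$ be the new response after censoring, and $$\mathrm{ICMSE}(\bm x_{n+1})=\int_{[0,1]^p}\mathbb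 E_{Y_{n+1}\mid\mathcal Y_n}\big[\mathrm{Var}(\xi(\bm x_{\rm new})\mid\mathcal Y_n,Y_{n+1})\big]\,d\bm x_{\rm new}.$$ Put $\bm\Gamma_{n+1}=\sigma_\xi^2[R(\bm x_i,\bm x_j)]_{i,j\le n+1}+\sigma_\epsilon^2\bm I$, $\bm\gamma_{n+1,\rm new}=\sigma_\xi^2[R(\bm x_i,\bm x_{\rm new})]_{i\le n+1}$ and $\sigma^2_{\rm new}=\mathrm{Var}[\xi(\bm x_{\rm new})\mid\mathcal Y_n]$. Then conditioning on $\mathcal Y_n$ gives a probability law under which every $\xi(\bm x_{\rm new})$ is square integrable, $\bm\Gamma_{n+1}$ is positive definite, the integrand of $\mathrm{ICMSE}$ is integrable, and $$\mathrm{ICMSE}(\bm x_{n+1})=\int_{[0,1]^p}\Big(\sigma^2_{\rm new}-\bm\gamma_{n+1,\rm new}^T\bm\Gamma_{n+1}^{-1}\bm H_c(\bm x_{n+1})\bm\Gamma_{n+1}^{-1}\bm\gamma_{n+1,\rm new}\Big)\,d\bm x_{\rm new},$$ $$\bm H_c(\bm x_{n+1})=(1-\lambda)(\bm\Sigma_1-\hat{\bm\Sigma})+\lambda(1-\lambda)\,\bm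 d\bm d^T .$$ Here, with $\bm\Gamma_{n+1}$ split into blocks for the observed ($o$) and the latent ($l$: censored and new) responses, the conditional law of $(\bm y_c',Y'_{n+1})$ given $\bm y_o$ is the multivariate normal law with mean $\mu_\xi\bm 1+\bm\Gamma_{lo}\bm\Gamma_{oo}^{-1}(\bm y_o-\mu_\xi\bm 1)$ and covariance $\bm\Gamma_{ll}-\bm\Gamma_{lo}\bm\Gamma_{oo}^{-1}\bm\Gamma_{ol}$, and all ingredients of $\bm H_c$ are orthant probabilities and truncated moments of this law: $\lambda=\mathbb P(\bm y_c'\ge\bm c,\,Y'_{n+1}\ge c\mid\bm y_o)/\mathbb P(\bm y_c'\ge\bm c\mid\bm y_o)$; $\bm\Sigma_1=\mathrm{diag}\big(\bm 0_{n_o},\ \mathrm{Var}((\bm y_c',Y'_{n+1})\mid\bm y_o,\bm y_c'\ge\bm c,Y'_{n+1}<c)\big)$; $\hat{\bm\Sigma}=\mathrm{diag}\big(\bm 0_{n_o},\ \mathbb E[\mathrm{Var}(\bm y_c'\mid Y'_{n+1},\bm y_o,\bm y_c'\ge\bm c)\mid\bm y_o,\bm y_c'\ge\bm c,Y'_{n+1}<c],\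 0\big)$; and $\bm d=\big(\bm 0_{n_o},\ \mathbb E[(\bm y_c',Y'_{n+1})\mid\bm y_o,\bm y_c'\ge\bm c,Y'_{n+1}\ge c]-\mathbb E[(\bm y_c',Y'_{n+1})\mid\bm y_o,\bm y_c'\ge\bm c,Y'_{n+1}<c]\big)$. -/

import Mathlib

open MeasureTheory ProbabilityTheory
open scoped NNReal ENNReal Matrix

namespace CensoredGP

/-- The input domain `[0,1]^p`; its `volume` is Lebesgue measure. -/
abbrev Cube (p : ℕ) : Type := Fin p → unitInterval

/-- Indices of the responses that are not recorded exactly: the `nc` censored training runs and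
the one potential new run. -/
abbrev Latent (nc : ℕ) : Type := Fin nc ⊕ Unit

/-- Indices of all `n + 1 = no + nc + 1` runs, in the order observed, censored, new. -/
abbrev Run (no nc : ℕ) : Type := Fin no ⊕ Latent nc

/-- The inputs `x_1, …, x_{n+1}`. -/
def design {p no nc : ℕ} (xo : Fin no → Cube p) (xc : Fin nc → Cube p) (xnext : Cube p) :
    Run no nc → Cube p :=
  Sum.elim xo (Sum.elim xc fun _ => xnext)

/-- The model: `ξ` is a Gaussian process with constant mean `μ`, variance `σξ ^ 2` and correlation
function `R`; the noise variables `ε i` are i.i.d. `N(0, σε ^ 2)`, independent of `ξ`. -/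
structure IsModel {p no nc : ℕ} {Ω : Type*} [MeasurableSpace Ω] (P : Measure Ω)
    (ξ : Cube p → Ω → ℝ) (ε : Run no nc → Ω → ℝ)
    (μ σξ : ℝ) (R : Cube p → Cube p → ℝ) (σε : ℝ≥0) : Prop where
  measurable_process : ∀ x, Measurable (ξ x)
  gaussian_process : IsGaussianProcess ξ P
  mean_process : ∀ x, ∫ ω, ξ x ω ∂P = μ
  cov_process : ∀ x x', covariance (ξ x) (ξ x') P = σξ ^ 2 * R x x'
  corr_self : ∀ x, R x x = 1
  measurable_noise : ∀ i, Measurable (ε i)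
  law_noise : ∀ i, P.map (ε i) = gaussianReal 0 (σε ^ 2)
  indep_noise : iIndepFun ε P
  indep_process_noise : IndepFun (fun ω x => ξ x ω) (fun ω i => ε i ω) P

section Posterior

variable {p no nc : ℕ} {Ω : Type*} [MeasurableSpace Ω]

/-- The responses prior to censoring, `y'_i = ξ(x_i) + ε_i`. -/
def response (ξ : Cube p → Ω → ℝ) (ε : Run no nc → Ω → ℝ) (x : Run no nc → Cube p)
    (i : Run no nc) (ω : Ω) : ℝ :=
  ξ (x i) ω + ε i ω

open Classical in
/-- Right-censoring at the limit `c`. -/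
noncomputable def censor (c y : ℝ) : ℝ := if c ≤ y then c else y

/-- Likelihood of the exactly observed values `yo` at the inputs `xo`, given `ξ`. -/
noncomputable def likelihood (ξ : Cube p → Ω → ℝ) (σε : ℝ≥0) (xo : Fin no → Cube p)
    (yo : Fin no → ℝ) (ω : Ω) : ℝ≥0∞ :=
  ∏ i, gaussianPDF (ξ (xo i) ω) (σε ^ 2) (yo i)

/-- The posterior given `y_o = yo` (Bayes' formula: the prior reweighted by the likelihood and
normalized), as a law of the process `ξ` and of the noise of the censored and the new runs. The
lemma `measure_inter_response_eq` below says that this is the conditional law. -/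
noncomputable def posteriorObs (P : Measure Ω) (ξ : Cube p → Ω → ℝ) (σε : ℝ≥0)
    (xo : Fin no → Cube p) (yo : Fin no → ℝ) : Measure Ω :=
  cond (P.withDensity (likelihood ξ σε xo yo)) Set.univ

/-- The posterior given the censored data `{y_o = yo, y_c' ≥ c}`. -/
noncomputable def posteriorData (P : Measure Ω) (ξ : Cube p → Ω → ℝ) (ε : Run no nc → Ω → ℝ)
    (σε : ℝ≥0) (x : Run no nc → Cube p) (c : ℝ) (yo : Fin no → ℝ) : Measure Ω :=
  cond (posteriorObs P ξ σε (fun i => x (Sum.inl i)) yo)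
    {ω | ∀ j : Fin nc, c ≤ response ξ ε x (Sum.inr (Sum.inl j)) ω}

/-- The expectation of `Var(ξ(z) | data, Y_{n+1})` over `Y_{n+1} | data`, where `Q` is the law given
the data and `Y_{n+1}` is the new response after censoring. -/
noncomputable def cmse (Q : Measure Ω) (ξ : Cube p → Ω → ℝ) (ε : Run no nc → Ω → ℝ)
    (x : Run no nc → Cube p) (c : ℝ) (z : Cube p) : ℝ :=
  ∫ ω, condVar (MeasurableSpace.comap
    (fun ω => censor c (response ξ ε x (Sum.inr (Sum.inr ())) ω)) inferInstance) (ξ z) Q ω ∂Q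

/-- The ICMSE criterion, as a function of all inputs `x` (the last one is `x_{n+1}`). -/
noncomputable def icmse (Q : Measure Ω) (ξ : Cube p → Ω → ℝ) (ε : Run no nc → Ω → ℝ)
    (x : Run no nc → Cube p) (c : ℝ) : ℝ :=
  ∫ z, cmse Q ξ ε x c z

lemma lintegral_pi_prod {n : ℕ} (ν : Fin n → Measure ℝ) [∀ i, SigmaFinite (ν i)]
    (f : Fin n → ℝ → ℝ≥0∞) (hf : ∀ i, Measurable (f i)) :
    ∫⁻ y, ∏ i, f i (y i) ∂(Measure.pi ν) = ∏ i, ∫⁻ t, f i t ∂(ν i) := by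
  induction n with
  | zero => simp
  | succ n ih =>
    rw [← ((measurePreserving_piFinSuccAbove ν 0).symm).lintegral_comp_emb
      (MeasurableEquiv.measurableEmbedding _)]
    simp_rw [MeasurableEquiv.piFinSuccAbove_symm_apply, Fin.insertNthEquiv,
      Fin.prod_univ_succ, Fin.insertNth_zero, Equiv.coe_fn_mk, Fin.cons_succ,
      Fin.zero_succAbove, Fin.cons_zero]
    rw [← ih (fun i => ν i.succ) (fun i => f i.succ) (fun i => hf _)]
    refine lintegral_prod_mul (f := f 0) (g := fun y : Fin n → ℝ => ∏ i : Fin n, f i.succ (y i))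
      (hf 0).aemeasurable (Measurable.aemeasurable ?_)
    exact Finset.measurable_prod _ fun i _ => (hf i.succ).comp (measurable_pi_apply i)

lemma pi_gaussian_shift (v : ℝ≥0) (hv : v ≠ 0) (a : Fin no → ℝ) (B : Set (Fin no → ℝ))
    (hB : MeasurableSet B) :
    (Measure.pi fun _ : Fin no => gaussianReal 0 v) {u | (fun i => a i + u i) ∈ B} =
      ∫⁻ y in B, ∏ i, gaussianPDF (a i) v (y i) := by
  have h1 : (Measure.pi fun _ : Fin no => gaussianReal 0 v).map (fun u i => a i + u i) =
      Measure.pi fun i => gaussianReal (a i) v := by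
    rw [Measure.pi_map_pi (hμ := fun i => by infer_instance)
      (f := fun i u => a i + u) (fun i => by fun_prop)]
    congr 1
    funext i
    rw [gaussianReal_map_const_add]
    simp
  have h2 : (Measure.pi fun i => gaussianReal (a i) v) =
      volume.withDensity (fun y : Fin no → ℝ => ∏ i, gaussianPDF (a i) v (y i)) := by
    refine Measure.pi_eq fun s hs => ?_
    rw [withDensity_apply _ (MeasurableSet.univ_pi hs), volume_pi, Measure.restrict_pi_pi,
      lintegral_pi_prod _ (fun i => gaussianPDF (a i) v) fun i => measurable_gaussianPDF _ _]
    simp_rw [gaussianReal_apply _ hv]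
  have h3 : Measurable fun (u : Fin no → ℝ) i => a i + u i := by fun_prop
  have h4 : {u | (fun i => a i + u i) ∈ B} = (fun (u : Fin no → ℝ) i => a i + u i) ⁻¹' B := rfl
  rw [h4, ← Measure.map_apply h3 hB, h1, h2, withDensity_apply _ hB]

/-- The unnormalized posterior disintegrates the model along `y_o`: for events in terms of the
process `ξ` and the noise of the censored and the new runs, the density of `y_o` jointly with the
event is the reweighted prior probability of the event. -/
theorem measure_inter_response_eq {P : Measure Ω} {ξ : Cube p → Ω → ℝ} {ε : Run no nc → Ω → ℝ}
    {μ σξ : ℝ} {R : Cube p → Cube p → ℝ} {σε : ℝ≥0} (h : IsModel P ξ ε μ σξ R σε) (hσε : 0 < σε)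
    (x : Run no nc → Cube p) {B : Set (Fin no → ℝ)} (hB : MeasurableSet B)
    {T : Set ((Cube p → ℝ) × (Latent nc → ℝ))} (hT : MeasurableSet T) :
    P {ω | (fun i => response ξ ε x (Sum.inl i) ω) ∈ B ∧
        ((fun z => ξ z ω, fun l => ε (Sum.inr l) ω) : (Cube p → ℝ) × (Latent nc → ℝ)) ∈ T} =
      ∫⁻ yo in B, P.withDensity (likelihood ξ σε (fun i => x (Sum.inl i)) yo)
        {ω | ((fun z => ξ z ω, fun l => ε (Sum.inr l) ω) :
          (Cube p → ℝ) × (Latent nc → ℝ)) ∈ T} := by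
  have hP : IsProbabilityMeasure P := h.indep_noise.isProbabilityMeasure
  have hv : σε ^ 2 ≠ 0 := (pow_pos hσε 2).ne'
  set A : Ω → Cube p → ℝ := fun ω z => ξ z ω with hA_def
  set U : Ω → Fin no → ℝ := fun ω i => ε (Sum.inl i) ω with hU_def
  set W : Ω → Latent nc → ℝ := fun ω l => ε (Sum.inr l) ω with hW_def
  have hA : Measurable A := measurable_pi_lambda _ h.measurable_process
  have hU : Measurable U := measurable_pi_lambda _ fun i => h.measurable_noise _
  have hW : Measurable W := measurable_pi_lambda _ fun i => h.measurable_noise _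
  have hUlaw : P.map U = Measure.pi fun _ : Fin no => gaussianReal 0 (σε ^ 2) := by
    have := (h.indep_noise.precomp (g := Sum.inl) Sum.inl_injective).map_fun_eq_pi_map
      (fun i => (h.measurable_noise (Sum.inl i)).aemeasurable)
    simp_rw [h.law_noise] at this
    exact this
  have hUW : IndepFun U W P := by
    classical
    have h0 := h.indep_noise.indepFun_finset (Finset.univ.image Sum.inl) (Finset.univ.image Sum.inr)
      (by
        rw [Finset.disjoint_left]
        intro a ha hb
        simp only [Finset.mem_image, Finset.mem_univ, true_and] at ha hb
        obtain ⟨i, rfl⟩ := ha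
        obtain ⟨j, hj⟩ := hb
        cases hj) h.measurable_noise
    exact h0.comp
      (φ := fun f (i : Fin no) => f ⟨Sum.inl i, by simp⟩)
      (ψ := fun f (l : Latent nc) => f ⟨Sum.inr l, by simp⟩)
      (measurable_pi_lambda _ fun i => measurable_pi_apply _)
      (measurable_pi_lambda _ fun i => measurable_pi_apply _)
  have hAUW : IndepFun A (fun ω => (U ω, W ω)) P := by
    refine h.indep_process_noise.comp (φ := id)
      (ψ := fun f => ((fun i => f (Sum.inl i), fun l => f (Sum.inr l)) :
        (Fin no → ℝ) × (Latent nc → ℝ))) measurable_id ?_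
    fun_prop
  have hAW : IndepFun A W P := hAUW.comp (φ := id) (ψ := Prod.snd) measurable_id measurable_snd
  have m1 := (indepFun_iff_map_prod_eq_prod_map_map hU.aemeasurable hW.aemeasurable).1 hUW
  have m2 := (indepFun_iff_map_prod_eq_prod_map_map hA.aemeasurable
    (hU.prodMk hW).aemeasurable).1 hAUW
  have m3 := (indepFun_iff_map_prod_eq_prod_map_map hA.aemeasurable hW.aemeasurable).1 hAW
  have pA : IsProbabilityMeasure (P.map A) := Measure.isProbabilityMeasure_map hA.aemeasurable
  have pU : IsProbabilityMeasure (P.map U) := Measure.isProbabilityMeasure_map hU.aemeasurable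
  have pW : IsProbabilityMeasure (P.map W) := Measure.isProbabilityMeasure_map hW.aemeasurable
  let L : (Cube p → ℝ) → (Fin no → ℝ) → ℝ≥0∞ := fun a y =>
    ∏ i, gaussianPDF (a (x (Sum.inl i))) (σε ^ 2) (y i)
  have hL : Measurable fun q : (Cube p → ℝ) × (Fin no → ℝ) => L q.1 q.2 := by
    refine Finset.measurable_prod _ fun i _ => ?_
    simp only [gaussianPDF, gaussianPDFReal]
    fun_prop
  have hS : MeasurableSet {q : (Cube p → ℝ) × ((Fin no → ℝ) × (Latent nc → ℝ)) |
      (fun i => q.1 (x (Sum.inl i)) + q.2.1 i) ∈ B ∧ (q.1, q.2.2) ∈ T} := by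
    refine MeasurableSet.inter ?_ ?_
    · exact measurableSet_preimage (f := fun q : (Cube p → ℝ) × ((Fin no → ℝ) × (Latent nc → ℝ)) =>
        fun i => q.1 (x (Sum.inl i)) + q.2.1 i) (by fun_prop) hB
    · exact measurableSet_preimage (f := fun q : (Cube p → ℝ) × ((Fin no → ℝ) × (Latent nc → ℝ)) =>
        (q.1, q.2.2)) (by fun_prop) hT
  have lhs : P {ω | (fun i => response ξ ε x (Sum.inl i) ω) ∈ B ∧ (A ω, W ω) ∈ T} =
      ∫⁻ a, (∫⁻ y in B, L a y) * (P.map W) (Prod.mk a ⁻¹' T) ∂(P.map A) := by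
    have e : {ω | (fun i => response ξ ε x (Sum.inl i) ω) ∈ B ∧ (A ω, W ω) ∈ T} =
      (fun ω => (A ω, (U ω, W ω))) ⁻¹' {q : (Cube p → ℝ) × ((Fin no → ℝ) × (Latent nc → ℝ)) |
        (fun i => q.1 (x (Sum.inl i)) + q.2.1 i) ∈ B ∧ (q.1, q.2.2) ∈ T} := rfl
    rw [e, ← Measure.map_apply (hA.prodMk (hU.prodMk hW)) hS, m2, m1, Measure.prod_apply hS]
    refine lintegral_congr fun a => ?_
    have e2 : Prod.mk a ⁻¹' {q : (Cube p → ℝ) × ((Fin no → ℝ) × (Latent nc → ℝ)) |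
        (fun i => q.1 (x (Sum.inl i)) + q.2.1 i) ∈ B ∧ (q.1, q.2.2) ∈ T} =
        {u | (fun i => a (x (Sum.inl i)) + u i) ∈ B} ×ˢ (Prod.mk a ⁻¹' T) := rfl
    rw [e2, Measure.prod_prod, hUlaw, pi_gaussian_shift _ hv _ _ hB]
  have rhs : ∀ yo, P.withDensity (likelihood ξ σε (fun i => x (Sum.inl i)) yo)
      {ω | (A ω, W ω) ∈ T} = ∫⁻ a, L a yo * (P.map W) (Prod.mk a ⁻¹' T) ∂(P.map A) := by
    intro yo
    have hLy : Measurable fun a => L a yo := Measurable.of_uncurry_right (f := L) hL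
    have hE : MeasurableSet {ω | (A ω, W ω) ∈ T} :=
      measurableSet_preimage (f := fun ω => (A ω, W ω)) (hA.prodMk hW) hT
    rw [withDensity_apply _ hE, ← lintegral_indicator hE]
    have e : ∀ ω, {ω | (A ω, W ω) ∈ T}.indicator
        (likelihood ξ σε (fun i => x (Sum.inl i)) yo) ω =
        (fun q : (Cube p → ℝ) × (Latent nc → ℝ) => T.indicator (fun q => L q.1 yo) q)
          (A ω, W ω) := fun ω => rfl
    have hm : Measurable fun q : (Cube p → ℝ) × (Latent nc → ℝ) =>
        T.indicator (fun q => L q.1 yo) q := (hLy.comp measurable_fst).indicator hT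
    rw [lintegral_congr e, ← lintegral_map hm (hA.prodMk hW), m3, lintegral_prod _ hm.aemeasurable]
    refine lintegral_congr fun a => ?_
    have e3 : ∀ w, T.indicator (fun q : (Cube p → ℝ) × (Latent nc → ℝ) => L q.1 yo) (a, w) =
        (Prod.mk a ⁻¹' T).indicator (fun _ => L a yo) w := fun w => rfl
    rw [lintegral_congr e3, lintegral_indicator (measurable_prodMk_left hT), lintegral_const,
      Measure.restrict_apply_univ]
  have hK : Measurable fun a => (P.map W) (Prod.mk a ⁻¹' T) := measurable_measure_prodMk_left hT
  refine lhs.trans (Eq.trans ?_ (lintegral_congr fun yo => (rhs yo).symm))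
  rw [lintegral_lintegral_swap]
  · refine lintegral_congr fun a => ?_
    rw [lintegral_mul_const]
    exact Measurable.of_uncurry_left (f := L) hL
  · refine Measurable.aemeasurable ?_
    exact (hL.comp measurable_swap).mul (hK.comp measurable_snd)

end Posterior

section Adjustment

/-- `Γ = σξ² [R(x_i, x_j)] + σε² I`, the covariance matrix of the responses at the inputs `x`. -/
noncomputable def covMatrix {p : ℕ} {ι : Type*} [DecidableEq ι] (σξ : ℝ)
    (R : Cube p → Cube p → ℝ) (σε : ℝ≥0) (x : ι → Cube p) : Matrix ι ι ℝ :=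
  σξ ^ 2 • Matrix.of (fun i j => R (x i) (x j)) + (σε : ℝ) ^ 2 • 1

/-- `γ_new = σξ² [R(x_i, z)]`. -/
def crossCov {p : ℕ} {ι : Type*} (σξ : ℝ) (R : Cube p → Cube p → ℝ) (x : ι → Cube p)
    (z : Cube p) : ι → ℝ :=
  fun i => σξ ^ 2 * R (x i) z

variable {no nc : ℕ}

/-- Conditional mean `μ 1 + Γ_{lo} Γ_{oo}⁻¹ (y_o - μ 1)` of the latent responses
`(y_c', Y'_{n+1})` given `y_o`, where `Γ` is the covariance matrix of all responses. -/
noncomputable def latentMean (Γ : Matrix (Run no nc) (Run no nc) ℝ) (μ : ℝ) (yo : Fin no → ℝ) :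
    Latent nc → ℝ :=
  fun l => μ + (Γ.toBlocks₂₁ *ᵥ (Γ.toBlocks₁₁⁻¹ *ᵥ fun i => yo i - μ)) l

/-- Conditional covariance `Γ_{ll} - Γ_{lo} Γ_{oo}⁻¹ Γ_{ol}` of the latent responses
`(y_c', Y'_{n+1})` given `y_o`. -/
noncomputable def latentCov (Γ : Matrix (Run no nc) (Run no nc) ℝ) :
    Matrix (Latent nc) (Latent nc) ℝ :=
  Γ.toBlocks₂₂ - Γ.toBlocks₂₁ * Γ.toBlocks₁₁⁻¹ * Γ.toBlocks₁₂

/-- The multivariate normal law of `(y_c', Y'_{n+1})` given `y_o`. -/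
noncomputable def latentLaw (Γ : Matrix (Run no nc) (Run no nc) ℝ) (μ : ℝ) (yo : Fin no → ℝ) :
    Measure (EuclideanSpace ℝ (Latent nc)) :=
  multivariateGaussian (WithLp.toLp 2 (latentMean Γ μ yo)) (latentCov Γ)

/-- `λ = P(y_c' ≥ c, Y'_{n+1} ≥ c | y_o) / P(y_c' ≥ c | y_o)`, a ratio of orthant probabilities of
the law `ν` of `(y_c', Y'_{n+1})` given `y_o`. -/
noncomputable def censProb (ν : Measure (EuclideanSpace ℝ (Latent nc))) (c : ℝ) : ℝ :=
  ν.real {w | ∀ l, c ≤ w l} / ν.real {w | ∀ j : Fin nc, c ≤ w (Sum.inl j)}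

/-- The law of `(y_c', Y'_{n+1})` given `y_o`, `y_c' ≥ c` and `Y'_{n+1} ≥ c`: a truncation of
`ν`. -/
noncomputable def truncAbove (ν : Measure (EuclideanSpace ℝ (Latent nc))) (c : ℝ) :
    Measure (EuclideanSpace ℝ (Latent nc)) :=
  cond ν {w | (∀ j : Fin nc, c ≤ w (Sum.inl j)) ∧ c ≤ w (Sum.inr ())}

/-- The law of `(y_c', Y'_{n+1})` given `y_o`, `y_c' ≥ c` and `Y'_{n+1} < c`: a truncation of
`ν`. -/
noncomputable def truncBelow (ν : Measure (EuclideanSpace ℝ (Latent nc))) (c : ℝ) :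
    Measure (EuclideanSpace ℝ (Latent nc)) :=
  cond ν {w | (∀ j : Fin nc, c ≤ w (Sum.inl j)) ∧ w (Sum.inr ()) < c}

/-- The conditional covariance of `X` and `Y` given the σ-algebra `m`. -/
noncomputable def condCov {Ω : Type*} {m₀ : MeasurableSpace Ω} (m : MeasurableSpace Ω)
    (X Y : Ω → ℝ) (τ : Measure[m₀] Ω) : Ω → ℝ :=
  condExp m τ ((X - condExp m τ X) * (Y - condExp m τ Y))

/-- `Σ₁ = diag(0, Var((y_c', Y'_{n+1}) | y_o, y_c' ≥ c, Y'_{n+1} < c))`. -/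
noncomputable def sigmaOne (no : ℕ) (ν : Measure (EuclideanSpace ℝ (Latent nc))) (c : ℝ) :
    Matrix (Run no nc) (Run no nc) ℝ :=
  Matrix.fromBlocks 0 0 0
    (Matrix.of fun k l => covariance (fun w => w k) (fun w => w l) (truncBelow ν c))

/-- `Σ̂ = diag(0, E[Var(y_c' | Y'_{n+1}, y_o, y_c' ≥ c)], 0)`, with the expectation over `Y'_{n+1}`
given `y_o`, `y_c' ≥ c` and `Y'_{n+1} < c`. -/
noncomputable def sigmaHat (no : ℕ) (ν : Measure (EuclideanSpace ℝ (Latent nc))) (c : ℝ) :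
    Matrix (Run no nc) (Run no nc) ℝ :=
  Matrix.fromBlocks 0 0 0 (Matrix.fromBlocks
    (Matrix.of fun j k : Fin nc => ∫ w, condCov
      (MeasurableSpace.comap (fun w : EuclideanSpace ℝ (Latent nc) => w (Sum.inr ())) inferInstance)
      (fun w => w (Sum.inl j)) (fun w => w (Sum.inl k)) (truncBelow ν c) w ∂(truncBelow ν c))
    0 0 0)

/-- The difference of the expected response vectors given `y_c' ≥ c` and, respectively,
`Y'_{n+1} ≥ c` and `Y'_{n+1} < c`; it vanishes at the observed runs. -/
noncomputable def meanGap (no : ℕ) (ν : Measure (EuclideanSpace ℝ (Latent nc))) (c : ℝ) :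
    Run no nc → ℝ :=
  Sum.elim 0 fun l => (∫ w, w l ∂(truncAbove ν c)) - ∫ w, w l ∂(truncBelow ν c)

/-- The matrix `H_c(x_{n+1}) = (1 - λ)(Σ₁ - Σ̂) + λ (1 - λ) d dᵀ` with `d` the mean gap, built from
the law `ν` of the latent responses given `y_o`. -/
noncomputable def Hc (no : ℕ) (ν : Measure (EuclideanSpace ℝ (Latent nc))) (c : ℝ) :
    Matrix (Run no nc) (Run no nc) ℝ :=
  (1 - censProb ν c) • (sigmaOne no ν c - sigmaHat no ν c) +
    (censProb ν c * (1 - censProb ν c)) • Matrix.vecMulVec (meanGap no ν c) (meanGap no ν c)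

end Adjustment

end CensoredGP

open CensoredGP

/-! Put `β = Γ⁻¹ γ`. Given `y_o`, the latent vector `W = (y_c', Y'_{n+1})` has the law `ν`, and `ξ z
= ∑ β_l W_l + r`, where the remainder `r` is a constant plus the kriging residual and is independent
of `W`. Censoring conditions on an event about `W` alone, so this decomposition and the independence
survive under the posterior given all data (`IsModel.map_posteriorData`).

The law of total variance then gives `E Var(ξ z | Y) = Var(ξ z) - βᵀ C β`, with `C` the covariance
matrix of `E[W | Y]` under `ν` truncated to `y_c' ≥ c` (`integral_condVar_censor`). That truncation
is a mixture, with weights `λ` and `1 - λ`, of the laws `truncAbove` and `truncBelow`. On the first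
`Y` is the constant `c`, so `E[W | Y]` is a constant; on the second `Y` equals `Y'_{n+1}`, so the
covariance of `E[W | Y]` is `Σ₁ - Σ̂` by the law of total covariance. The two different means add
the rank-one term `λ (1 - λ) d dᵀ`, hence `C` is the latent block of `H_c`
(`covariance_condExp_censor`, `covariance_condExp_eq_Hc`).

The posterior given `y_o` is defined by Bayes' formula at each single value `yo`, whereas
disintegration identifies it only for almost every value. `IsModel.map_posteriorObs_eq` removes the
exceptional set by continuity in the data.

Integrability in `z` holds because the integrand is a fixed continuous function of the bounded
measurable vector `γ z`. -/

namespace CensoredGP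

/-! ### Bounds, positivity and continuity of the Gaussian likelihood. -/

section Likelihood

variable {p no nc : ℕ} {Ω : Type*} [MeasurableSpace Ω]

lemma measurable_likelihood_uncurry {ξ : Cube p → Ω → ℝ} (hξ : ∀ x, Measurable (ξ x)) (σε : ℝ≥0)
    (xo : Fin no → Cube p) :
    Measurable fun q : (Fin no → ℝ) × Ω => likelihood ξ σε xo q.1 q.2 := by
  refine Finset.measurable_prod _ fun i _ => ?_
  simp only [gaussianPDF, gaussianPDFReal]
  fun_prop (disch := exact hξ _)

lemma measurable_likelihood {ξ : Cube p → Ω → ℝ} (hξ : ∀ x, Measurable (ξ x)) (σε : ℝ≥0)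
    (xo : Fin no → Cube p) (y : Fin no → ℝ) : Measurable (likelihood ξ σε xo y) :=
  Measurable.of_uncurry_left (f := fun y ω => likelihood ξ σε xo y ω)
    (measurable_likelihood_uncurry hξ σε xo)

omit [MeasurableSpace Ω] in
lemma continuous_likelihood (ξ : Cube p → Ω → ℝ) (σε : ℝ≥0) (xo : Fin no → Cube p) (ω : Ω) :
    Continuous fun y => likelihood ξ σε xo y ω := by
  -- Multiplication on `ℝ≥0∞` is not continuous at `0 · ∞`, so continuity is proved for the product
  -- of the real densities.
  have h : ∀ y, likelihood ξ σε xo y ω =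
      ENNReal.ofReal (∏ i, gaussianPDFReal (ξ (xo i) ω) (σε ^ 2) (y i)) := fun y => by
    rw [ENNReal.ofReal_prod_of_nonneg fun i _ => gaussianPDFReal_nonneg _ _ _]
    rfl
  simp_rw [h]
  refine ENNReal.continuous_ofReal.comp (continuous_finsetProd _ fun i _ => ?_)
  simp only [gaussianPDFReal]
  fun_prop

/-- The density is largest at its mean. The bound depends on neither `m` nor `t`, so it serves as
the constant for dominated convergence. -/
lemma gaussianPDF_le (m : ℝ) (v : ℝ≥0) (t : ℝ) :
    gaussianPDF m v t ≤ ENNReal.ofReal (√(2 * Real.pi * v))⁻¹ := by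
  refine ENNReal.ofReal_le_ofReal ?_
  rw [gaussianPDFReal]
  refine mul_le_of_le_one_right (by positivity) (Real.exp_le_one_iff.2 ?_)
  rw [neg_div]
  exact neg_nonpos.2 (by positivity)

omit [MeasurableSpace Ω] in
lemma likelihood_le (ξ : Cube p → Ω → ℝ) (σε : ℝ≥0) (xo : Fin no → Cube p) (y : Fin no → ℝ)
    (ω : Ω) : likelihood ξ σε xo y ω ≤
      ∏ _i : Fin no, ENNReal.ofReal (√(2 * Real.pi * (σε ^ 2 : ℝ≥0)))⁻¹ :=
  Finset.prod_le_prod' fun _ _ => gaussianPDF_le _ _ _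

omit [MeasurableSpace Ω] in
lemma likelihood_ne_zero (ξ : Cube p → Ω → ℝ) {σε : ℝ≥0} (hσε : 0 < σε) (xo : Fin no → Cube p)
    (y : Fin no → ℝ) (ω : Ω) : likelihood ξ σε xo y ω ≠ 0 :=
  Finset.prod_ne_zero_iff.2 fun _ _ => (gaussianPDF_pos _ (pow_pos hσε 2).ne' _).ne'

variable {P : Measure Ω} {ξ : Cube p → Ω → ℝ} {σε : ℝ≥0} {xo : Fin no → Cube p}

/-- Together with `lintegral_likelihood_ne_zero`, this makes the normalizing constant of Bayes'
formula invertible. -/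
lemma lintegral_likelihood_ne_top [IsFiniteMeasure P] (y : Fin no → ℝ) :
    ∫⁻ ω, likelihood ξ σε xo y ω ∂P ≠ ∞ := by
  refine ((lintegral_mono (likelihood_le ξ σε xo y)).trans_lt ?_).ne
  rw [lintegral_const]
  exact ENNReal.mul_lt_top (ENNReal.prod_lt_top fun _ _ => ENNReal.ofReal_lt_top)
    (measure_lt_top _ _)

lemma lintegral_likelihood_ne_zero [NeZero P] (hξ : ∀ x, Measurable (ξ x)) (hσε : 0 < σε)
    (y : Fin no → ℝ) : ∫⁻ ω, likelihood ξ σε xo y ω ∂P ≠ 0 := by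
  rw [Ne, lintegral_eq_zero_iff (measurable_likelihood hξ σε xo y)]
  intro h
  have h0 : ∀ᵐ ω ∂P, False := by
    filter_upwards [h] with ω hω using likelihood_ne_zero ξ hσε xo y ω hω
  exact NeZero.ne P (ae_eq_bot.1 (Filter.eventually_false_iff_eq_bot.1 h0))

lemma posteriorObs_eq_smul (y : Fin no → ℝ) :
    posteriorObs P ξ σε xo y =
      (∫⁻ ω, likelihood ξ σε xo y ω ∂P)⁻¹ • P.withDensity (likelihood ξ σε xo y) := by
  rw [posteriorObs, ProbabilityTheory.cond, Measure.restrict_univ, withDensity_apply _ MeasurableSet.univ,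
    Measure.restrict_univ]

lemma isProbabilityMeasure_posteriorObs [IsProbabilityMeasure P] (hξ : ∀ x, Measurable (ξ x))
    (hσε : 0 < σε) (y : Fin no → ℝ) : IsProbabilityMeasure (posteriorObs P ξ σε xo y) := by
  constructor
  rw [posteriorObs_eq_smul, Measure.smul_apply, withDensity_apply _ MeasurableSet.univ,
    Measure.restrict_univ, smul_eq_mul]
  exact ENNReal.inv_mul_cancel (lintegral_likelihood_ne_zero hξ hσε y)
    (lintegral_likelihood_ne_top y)

/-- The likelihood vanishes nowhere, so reweighting creates no new null sets. Positivity of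
truncation events thus passes from the prior to the posterior. -/
lemma absolutelyContinuous_posteriorObs [IsFiniteMeasure P] (hξ : ∀ x, Measurable (ξ x))
    (hσε : 0 < σε) (y : Fin no → ℝ) : P ≪ posteriorObs P ξ σε xo y := by
  rw [posteriorObs_eq_smul]
  refine (withDensity_absolutelyContinuous' (measurable_likelihood hξ σε xo y).aemeasurable
    (ae_of_all _ (likelihood_ne_zero ξ hσε xo y))).trans ?_
  exact Measure.absolutelyContinuous_smul (ENNReal.inv_ne_zero.2 (lintegral_likelihood_ne_top y))

lemma lintegral_posteriorObs (hξ : ∀ x, Measurable (ξ x)) (y : Fin no → ℝ) {F : Ω → ℝ≥0∞}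
    (hF : Measurable F) :
    ∫⁻ ω, F ω ∂(posteriorObs P ξ σε xo y) =
      (∫⁻ ω, likelihood ξ σε xo y ω ∂P)⁻¹ * ∫⁻ ω, likelihood ξ σε xo y ω * F ω ∂P := by
  rw [posteriorObs_eq_smul, lintegral_smul_measure, smul_eq_mul,
    lintegral_withDensity_eq_lintegral_mul _ (measurable_likelihood hξ σε xo y) hF]
  rfl

lemma continuous_lintegral_likelihood_mul [IsFiniteMeasure P] (hξ : ∀ x, Measurable (ξ x))
    {F : Ω → ℝ≥0∞} (hF : Measurable F) {C : ℝ≥0} (hC : ∀ ω, F ω ≤ C) :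
    Continuous fun y => ∫⁻ ω, likelihood ξ σε xo y ω * F ω ∂P := by
  refine continuous_iff_continuousAt.2 fun y₀ => ?_
  refine tendsto_lintegral_filter_of_dominated_convergence
    (fun _ => (∏ _i : Fin no, ENNReal.ofReal (√(2 * Real.pi * (σε ^ 2 : ℝ≥0)))⁻¹) * C)
    (Filter.Eventually.of_forall fun y => (measurable_likelihood hξ σε xo y).mul hF)
    (Filter.Eventually.of_forall fun y => ae_of_all _ fun ω =>
      mul_le_mul' (likelihood_le ξ σε xo y ω) (hC ω)) ?_ (ae_of_all _ fun ω => ?_)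
  · rw [lintegral_const]
    refine ENNReal.mul_ne_top (ENNReal.mul_ne_top ?_ ENNReal.coe_ne_top) (measure_ne_top _ _)
    exact (ENNReal.prod_lt_top fun _ _ => ENNReal.ofReal_lt_top).ne
  · exact ENNReal.Tendsto.mul_const ((continuous_likelihood ξ σε xo ω).tendsto y₀)
      (Or.inr ((hC ω).trans_lt ENNReal.coe_lt_top).ne)

end Likelihood

/-! ### The posterior at every value of the observed responses. -/

section PosteriorLaw

variable {p no nc : ℕ} {Ω : Type*} [MeasurableSpace Ω] {P : Measure Ω}
  {ξ : Cube p → Ω → ℝ} {ε : Run no nc → Ω → ℝ} {μ σξ : ℝ} {R : Cube p → Cube p → ℝ} {σε : ℝ≥0}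

lemma IsModel.measurable_response (h : IsModel P ξ ε μ σξ R σε) (x : Run no nc → Cube p)
    (i : Run no nc) : Measurable (response ξ ε x i) :=
  (h.measurable_process _).add (h.measurable_noise _)

/-- The process together with the noise of the latent runs. -/
def latentSource (ξ : Cube p → Ω → ℝ) (ε : Run no nc → Ω → ℝ) (ω : Ω) :
    (Cube p → ℝ) × (Latent nc → ℝ) :=
  (fun z => ξ z ω, fun l => ε (Sum.inr l) ω)

lemma IsModel.measurable_latentSource (h : IsModel P ξ ε μ σξ R σε) :
    Measurable (latentSource ξ ε) :=
  (measurable_pi_lambda _ h.measurable_process).prodMk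
    (measurable_pi_lambda _ fun _ => h.measurable_noise _)

/-- Extends `measure_inter_response_eq` from events to nonnegative functions: indicators, then sums,
then monotone limits. -/
lemma IsModel.setLIntegral_response (h : IsModel P ξ ε μ σξ R σε) (hσε : 0 < σε)
    (x : Run no nc → Cube p) {B : Set (Fin no → ℝ)} (hB : MeasurableSet B)
    {F : (Cube p → ℝ) × (Latent nc → ℝ) → ℝ≥0∞} (hF : Measurable F) :
    ∫⁻ ω in {ω | (fun i => response ξ ε x (Sum.inl i) ω) ∈ B}, F (latentSource ξ ε ω) ∂P =
      ∫⁻ y in B, ∫⁻ ω, likelihood ξ σε (fun i => x (Sum.inl i)) y ω *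
        F (latentSource ξ ε ω) ∂P := by
  have hP : IsProbabilityMeasure P := h.indep_noise.isProbabilityMeasure
  have hS := h.measurable_latentSource
  have hL := measurable_likelihood_uncurry h.measurable_process σε (fun i => x (Sum.inl i))
  have hLy := measurable_likelihood h.measurable_process σε (fun i => x (Sum.inl i))
  have hin : ∀ {f : (Cube p → ℝ) × (Latent nc → ℝ) → ℝ≥0∞}, Measurable f →
      Measurable fun y => ∫⁻ ω, likelihood ξ σε (fun i => x (Sum.inl i)) y ω *
        f (latentSource ξ ε ω) ∂P := fun hf =>
    Measurable.lintegral_prod_right' (f := fun q : (Fin no → ℝ) × Ω =>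
      likelihood ξ σε (fun i => x (Sum.inl i)) q.1 q.2 * _)
      (hL.mul ((hf.comp hS).comp measurable_snd))
  have hB' : MeasurableSet {ω | (fun i => response ξ ε x (Sum.inl i) ω) ∈ B} :=
    measurableSet_preimage (measurable_pi_lambda _ fun i => h.measurable_response x _) hB
  refine Measurable.ennreal_induction (motive := fun F => ∫⁻ ω in {ω | (fun i =>
    response ξ ε x (Sum.inl i) ω) ∈ B}, F (latentSource ξ ε ω) ∂P =
      ∫⁻ y in B, ∫⁻ ω, likelihood ξ σε (fun i => x (Sum.inl i)) y ω *
        F (latentSource ξ ε ω) ∂P) (fun a T hT => ?_) (fun f g _ hf hg ihf ihg => ?_)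
    (fun f hf hmono ih => ?_) hF
  · have e := measure_inter_response_eq h hσε x hB hT
    have hT' : MeasurableSet (latentSource ξ ε ⁻¹' T) := hS hT
    have hi : ∀ ω, T.indicator (fun _ => a) (latentSource ξ ε ω) =
        (latentSource ξ ε ⁻¹' T).indicator (fun _ => a) ω := fun _ => rfl
    simp_rw [hi]
    rw [lintegral_indicator hT', lintegral_const, Measure.restrict_restrict hT',
      Measure.restrict_apply_univ, Set.inter_comm]
    refine (congrArg (a * ·) e).trans ?_
    have hm : Measurable fun y => P.withDensity (likelihood ξ σε (fun i => x (Sum.inl i)) y)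
        (latentSource ξ ε ⁻¹' T) := by
      have := hin (f := T.indicator 1) (measurable_one.indicator hT)
      convert this using 2 with y
      rw [withDensity_apply _ hT', ← lintegral_indicator hT']
      refine lintegral_congr fun ω => ?_
      by_cases hω : latentSource ξ ε ω ∈ T <;> simp [Set.indicator, hω]
    refine (lintegral_const_mul a hm).symm.trans (lintegral_congr fun y => ?_)
    rw [withDensity_apply _ hT', ← lintegral_indicator hT', ← lintegral_const_mul a
      ((hLy y).indicator hT')]
    refine lintegral_congr fun ω => ?_
    by_cases hω : latentSource ξ ε ω ∈ T <;> simp [Set.indicator, hω, mul_comm]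
  · simp only [Pi.add_apply, mul_add]
    rw [lintegral_add_left (f := fun ω => f (latentSource ξ ε ω)) (hf.comp hS), ihf, ihg,
      ← lintegral_add_left (hin hf)]
    exact lintegral_congr fun y => (lintegral_add_left ((hLy y).mul (hf.comp hS)) _).symm
  · rw [lintegral_iSup (f := fun n ω => f n (latentSource ξ ε ω)) (fun n => (hf n).comp hS)
      (fun _ _ hmn ω => hmono hmn _)]
    simp_rw [ih]
    rw [← lintegral_iSup (fun n => hin (hf n)) (fun m n hmn y => lintegral_mono fun ω =>
      mul_le_mul_right (hmono hmn _) _)]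
    refine lintegral_congr fun y => ?_
    rw [← lintegral_iSup (f := fun n ω => likelihood ξ σε (fun i => x (Sum.inl i)) y ω *
      f n (latentSource ξ ε ω)) (fun n => (hLy y).mul ((hf n).comp hS)) (fun m n hmn ω =>
      mul_le_mul_right (hmono hmn _) _)]
    simp_rw [ENNReal.mul_iSup]

/-- If `V` is the sum of a continuous function of the observed responses and of a variable
independent of them, then its posterior law is obtained by plugging in the observed values. -/
theorem IsModel.map_posteriorObs_eq (h : IsModel P ξ ε μ σξ R σε) (hσε : 0 < σε)
    (x : Run no nc → Cube p) {E : Type*} [NormedAddCommGroup E] [MeasurableSpace E] [BorelSpace E]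
    [SecondCountableTopology E] {g : (Cube p → ℝ) × (Latent nc → ℝ) → E} (hg : Measurable g)
    {Φ : (Fin no → ℝ) → E} (hΦ : Continuous Φ) {V : Ω → E} (hV : Measurable V)
    (hgV : ∀ ω, g (latentSource ξ ε ω) = Φ (fun i => response ξ ε x (Sum.inl i) ω) + V ω)
    (hind : IndepFun (fun ω i => response ξ ε x (Sum.inl i) ω) V P) (yo : Fin no → ℝ) :
    (posteriorObs P ξ σε (fun i => x (Sum.inl i)) yo).map (fun ω => g (latentSource ξ ε ω)) =
      P.map fun ω => Φ yo + V ω := by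
  have hP : IsProbabilityMeasure P := h.indep_noise.isProbabilityMeasure
  have hξ := h.measurable_process
  have hgm : Measurable fun ω => g (latentSource ξ ε ω) := hg.comp h.measurable_latentSource
  have hY : Measurable fun ω i => response ξ ε x (Sum.inl i) ω :=
    measurable_pi_lambda _ fun i => h.measurable_response x _
  have hVm : ∀ y, Measurable fun ω => Φ y + V ω := fun y => hV.const_add _
  have hpost := isProbabilityMeasure_posteriorObs (P := P) (xo := fun i => x (Sum.inl i)) hξ hσε yo
  have hpm := Measure.isProbabilityMeasure_map (μ := posteriorObs P ξ σε (fun i => x (Sum.inl i)) yo)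
    hgm.aemeasurable
  -- Bounded continuous test functions suffice, and their continuity is what makes both sides
  -- continuous in the observed value.
  refine ext_of_forall_lintegral_eq_of_IsFiniteMeasure fun f => ?_
  have hfm : Measurable fun e => (f e : ℝ≥0∞) :=
    (ENNReal.continuous_coe.comp f.continuous).measurable
  obtain ⟨C, hC⟩ : ∃ C : ℝ≥0, ∀ e, (f e : ℝ≥0∞) ≤ C := by
    refine ⟨nndist 0 f, fun e => ENNReal.coe_le_coe.2 ?_⟩
    exact f.apply_le_nndist_zero e
  rw [lintegral_map hfm hgm, lintegral_map hfm (hVm yo), lintegral_posteriorObs hξ yo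
    (F := fun ω => (f (g (latentSource ξ ε ω)) : ℝ≥0∞)) (hfm.comp hgm)]
  set L := likelihood ξ σε (fun i => x (Sum.inl i)) with hL
  -- `k` is the marginal density of the observed responses and `ψ` the claimed posterior
  -- expectation; the aim is that the unnormalized posterior expectation is `k * ψ` at `yo`.
  set k : (Fin no → ℝ) → ℝ≥0∞ := fun y => ∫⁻ ω, L y ω ∂P with hk
  set ψ : (Fin no → ℝ) → ℝ≥0∞ := fun y => ∫⁻ ω, f (Φ y + V ω) ∂P with hψ
  have hkc : Continuous k := by
    have := continuous_lintegral_likelihood_mul (P := P) (σε := σε) (xo := fun i => x (Sum.inl i))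
      hξ (F := fun _ => 1) measurable_const (C := 1) (fun _ => le_rfl)
    simpa only [mul_one] using this
  have hhc : Continuous fun y => ∫⁻ ω, L y ω * f (g (latentSource ξ ε ω)) ∂P :=
    continuous_lintegral_likelihood_mul (P := P) hξ (hfm.comp hgm) (fun ω => hC _)
  have hψc : Continuous ψ := by
    refine continuous_iff_continuousAt.2 fun y₀ => ?_
    refine tendsto_lintegral_filter_of_dominated_convergence (fun _ => (C : ℝ≥0∞))
      (Filter.Eventually.of_forall fun y => hfm.comp (hVm y))
      (Filter.Eventually.of_forall fun y => ae_of_all _ fun ω => hC _) ?_ (ae_of_all _ fun ω => ?_)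
    · rw [lintegral_const]
      exact ENNReal.mul_ne_top ENNReal.coe_ne_top (measure_ne_top _ _)
    · exact (ENNReal.continuous_coe.comp (f.continuous.comp
        (hΦ.add continuous_const))).tendsto y₀
  have hψt : ∀ y, ψ y ≠ ∞ := fun y => by
    refine ((lintegral_mono fun ω => hC _).trans_lt ?_).ne
    rw [lintegral_const]
    exact ENNReal.mul_lt_top ENNReal.coe_lt_top (measure_lt_top _ _)
  have hlaw : P.map (fun ω i => response ξ ε x (Sum.inl i) ω) = volume.withDensity k := by
    ext B hB
    have := h.setLIntegral_response hσε x hB (F := fun _ => 1) measurable_const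
    simp only [mul_one, lintegral_one, Measure.restrict_apply_univ] at this
    rw [Measure.map_apply hY hB, withDensity_apply _ hB]
    exact this
  -- Over any `B`, both sides integrate to the expectation of `f ∘ g` on the event that the observed
  -- responses lie in `B`: the left by disintegration, the right by independence of `V` and the
  -- density `k`.
  have hae : (fun y => ∫⁻ ω, L y ω * f (g (latentSource ξ ε ω)) ∂P) =ᵐ[volume]
      fun y => k y * ψ y := by
    refine ae_eq_of_forall_setLIntegral_eq_of_sigmaFinite hhc.measurable
      (hkc.measurable.mul hψc.measurable) fun B hB _ => ?_
    rw [← h.setLIntegral_response hσε x hB (F := fun s => f (g s)) (hfm.comp hg)]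
    have hB' : MeasurableSet {ω | (fun i => response ξ ε x (Sum.inl i) ω) ∈ B} := hY hB
    rw [← lintegral_indicator hB']
    have hG : Measurable fun q : (Fin no → ℝ) × E => B.indicator (fun y => (f (Φ y + q.2) : ℝ≥0∞)) q.1 := by
      have : (fun q : (Fin no → ℝ) × E => B.indicator (fun y => (f (Φ y + q.2) : ℝ≥0∞)) q.1) =
          (Prod.fst ⁻¹' B).indicator fun q => (f (Φ q.1 + q.2) : ℝ≥0∞) := rfl
      rw [this]
      exact (hfm.comp ((hΦ.measurable.comp measurable_fst).add measurable_snd)).indicator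
        (measurable_fst hB)
    have e : ∀ ω, {ω | (fun i => response ξ ε x (Sum.inl i) ω) ∈ B}.indicator
        (fun ω => (f (g (latentSource ξ ε ω)) : ℝ≥0∞)) ω =
        (fun q : (Fin no → ℝ) × E => B.indicator (fun y => (f (Φ y + q.2) : ℝ≥0∞)) q.1)
          ((fun i => response ξ ε x (Sum.inl i) ω), V ω) := fun ω => by
      simp only [Set.indicator, hgV]
      rfl
    rw [lintegral_congr e, ← lintegral_map hG (hY.prodMk hV), hind.map_prod_eq_prod_map_map
      hY.aemeasurable hV.aemeasurable]
    have := Measure.isProbabilityMeasure_map (μ := P) hV.aemeasurable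
    rw [lintegral_prod _ hG.aemeasurable, hlaw, lintegral_withDensity_eq_lintegral_mul _
      hkc.measurable hG.lintegral_prod_right', ← lintegral_indicator hB]
    refine lintegral_congr fun y => ?_
    by_cases hy : y ∈ B
    · simp only [Pi.mul_apply, Set.indicator, hy, if_true]
      rw [lintegral_map (f := fun e => (f (Φ y + e) : ℝ≥0∞)) (hfm.comp (measurable_const_add _)) hV]
    · simp [Set.indicator, hy]
  -- Lebesgue measure charges every nonempty open set, so continuous functions that agree almost
  -- everywhere agree at `yo` as well.
  have hall := (Continuous.ae_eq_iff_eq (μ := (volume : Measure (Fin no → ℝ))) hhc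
    (continuous_iff_continuousAt.2 fun y => ENNReal.Tendsto.mul (hkc.tendsto y)
      (Or.inr (hψt y)) (hψc.tendsto y) (Or.inr (lintegral_likelihood_ne_top y)))).1 hae
  have hyo : ∫⁻ ω, L yo ω * f (g (latentSource ξ ε ω)) ∂P = k yo * ψ yo := congrFun hall yo
  refine (congrArg ((k yo)⁻¹ * ·) hyo).trans ?_
  change (k yo)⁻¹ * (k yo * ψ yo) = ψ yo
  rw [← mul_assoc, ENNReal.inv_mul_cancel (lintegral_likelihood_ne_zero hξ hσε yo)
    (lintegral_likelihood_ne_top yo), one_mul]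

end PosteriorLaw

/-! ### Gaussian vectors and their covariance matrices. -/

section Gaussian

variable {ι Ω : Type*} [Fintype ι] [MeasurableSpace Ω] {P : Measure Ω} {X : ι → Ω → ℝ}

/-- The quadratic form at `v` is the variance of `∑ v i * X i`. -/
lemma posSemidef_of_covariance [IsFiniteMeasure P] (hX : ∀ i, MemLp (X i) 2 P)
    {S : Matrix ι ι ℝ} (hS : ∀ i j, covariance (X i) (X j) P = S i j) : S.PosSemidef := by
  refine Matrix.PosSemidef.of_dotProduct_mulVec_nonneg ?_ fun v => ?_
  · ext i j
    rw [Matrix.conjTranspose_apply, star_trivial, ← hS, ← hS, covariance_comm]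
  · have hm : ∀ i, MemLp (fun ω => v i * X i ω) 2 P := fun i => (hX i).const_mul (v i)
    have hv := variance_nonneg (fun ω => ∑ i, v i * X i ω) P
    rw [← covariance_self (memLp_finsetSum _ fun i _ => hm i).aemeasurable,
      covariance_fun_sum_fun_sum hm hm] at hv
    simp_rw [covariance_const_mul_left, covariance_const_mul_right, hS] at hv
    refine hv.trans_eq ?_
    simp only [dotProduct, Matrix.mulVec, star_trivial, Finset.mul_sum]
    exact Finset.sum_congr rfl fun i _ => Finset.sum_congr rfl fun j _ => by ring

/-- A Gaussian vector has the multivariate Gaussian law given by its means and covariances. -/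
lemma map_eq_multivariateGaussian [DecidableEq ι]
    (hG : HasGaussianLaw (fun ω => WithLp.toLp 2 fun i => X i ω) P) {m : ι → ℝ}
    {S : Matrix ι ι ℝ} (hm : ∀ i, ∫ ω, X i ω ∂P = m i)
    (hS : ∀ i j, covariance (X i) (X j) P = S i j) :
    P.map (fun ω => WithLp.toLp 2 fun i => X i ω) = multivariateGaussian (WithLp.toLp 2 m) S := by
  have hP := hG.isProbabilityMeasure
  have hX : ∀ i, MemLp (X i) 2 P := fun i =>
    (hG.map_fun (EuclideanSpace.proj (𝕜 := ℝ) i)).memLp_two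
  have hpsd := posSemidef_of_covariance hX hS
  have := hG.isGaussian_map
  -- Two Gaussian laws agree once their means and covariance forms do; `hpsd` ensures that `S`
  -- really is the covariance of `multivariateGaussian`.
  refine IsGaussian.ext ?_ ?_
  · rw [integral_id_multivariateGaussian', integral_map hG.aemeasurable aestronglyMeasurable_id]
    ext i
    refine Eq.trans ?_ (hm i)
    exact ((EuclideanSpace.proj (𝕜 := ℝ) i).integral_comp_comm hG.integrable).symm
  · ext u v
    rw [covarianceBilin_multivariateGaussian hpsd, covarianceBilin_apply_pi hX]
    simp_rw [hS]
    simp only [dotProduct, Matrix.mulVec, Finset.mul_sum]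
    exact Finset.sum_congr rfl fun i _ => Finset.sum_congr rfl fun j _ => by ring

end Gaussian

/-! ### Joint Gaussianity and second moments of process and responses. -/

section Covariance

variable {p no nc : ℕ} {Ω : Type*} [MeasurableSpace Ω] {P : Measure Ω}
  {ξ : Cube p → Ω → ℝ} {ε : Run no nc → Ω → ℝ} {μ σξ : ℝ} {R : Cube p → Cube p → ℝ} {σε : ℝ≥0}

lemma IsModel.isProbabilityMeasure (h : IsModel P ξ ε μ σξ R σε) : IsProbabilityMeasure P :=
  h.indep_noise.isProbabilityMeasure

lemma IsModel.hasGaussianLaw_noise (h : IsModel P ξ ε μ σξ R σε) (i : Run no nc) :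
    HasGaussianLaw (ε i) P where
  isGaussian_map := by
    rw [h.law_noise]
    infer_instance

/-- The process at the inputs and at `z` is a Gaussian vector independent of the Gaussian noise
vector, so the pair is jointly Gaussian; the responses and `ξ z` are a linear image of it. -/
lemma IsModel.hasGaussianLaw_response (h : IsModel P ξ ε μ σξ R σε) (x : Run no nc → Cube p)
    (z : Cube p) :
    HasGaussianLaw (fun ω => ((fun i => response ξ ε x i ω, ξ z ω) : (Run no nc → ℝ) × ℝ)) P := by
  have hP := h.isProbabilityMeasure
  have hG := (h.gaussian_process.comp_right
    (fun o : Run no nc ⊕ Unit => Sum.elim x (fun _ => z) o)).hasGaussianLaw Finset.univ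
  have hE : HasGaussianLaw (fun ω i => ε i ω) P :=
    iIndepFun.hasGaussianLaw h.hasGaussianLaw_noise h.indep_noise
  have hI := h.indep_process_noise.comp (φ := fun a : Cube p → ℝ =>
    fun o : (Finset.univ : Finset (Run no nc ⊕ Unit)) => a (Sum.elim x (fun _ => z) o.1))
    (ψ := id) (measurable_pi_lambda _ fun _ => measurable_pi_apply _) measurable_id
  have hJ := IndepFun.hasGaussianLaw hG hE hI
  let L : (↥(Finset.univ : Finset (Run no nc ⊕ Unit)) → ℝ) × (Run no nc → ℝ) →ₗ[ℝ]
      (Run no nc → ℝ) × ℝ :=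
    { toFun := fun q => (fun i => q.1 ⟨Sum.inl i, Finset.mem_univ _⟩ + q.2 i,
        q.1 ⟨Sum.inr (), Finset.mem_univ _⟩)
      map_add' := fun a b => by
        ext
        · simp only [Prod.fst_add, Prod.snd_add, Pi.add_apply]; ring
        · simp
      map_smul' := fun a b => by
        ext
        · simp [mul_add]
        · simp }
  exact hJ.map_fun L.toContinuousLinearMap

lemma IsModel.memLp_process (h : IsModel P ξ ε μ σξ R σε) (z : Cube p) : MemLp (ξ z) 2 P :=
  (h.gaussian_process.hasGaussianLaw_eval z).memLp_two

lemma IsModel.memLp_noise (h : IsModel P ξ ε μ σξ R σε) (i : Run no nc) : MemLp (ε i) 2 P :=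
  (h.hasGaussianLaw_noise i).memLp_two

lemma IsModel.memLp_response (h : IsModel P ξ ε μ σξ R σε) (x : Run no nc → Cube p)
    (i : Run no nc) : MemLp (response ξ ε x i) 2 P :=
  (h.memLp_process _).add (h.memLp_noise i)

lemma IsModel.integral_noise (h : IsModel P ξ ε μ σξ R σε) (i : Run no nc) :
    ∫ ω, ε i ω ∂P = 0 := by
  have := integral_map (μ := P) (h.measurable_noise i).aemeasurable
    (f := fun t : ℝ => t) aestronglyMeasurable_id
  rw [← this, h.law_noise, integral_id_gaussianReal]

lemma IsModel.integral_response (h : IsModel P ξ ε μ σξ R σε) (x : Run no nc → Cube p)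
    (i : Run no nc) : ∫ ω, response ξ ε x i ω ∂P = μ := by
  have hP := h.isProbabilityMeasure
  simp only [response]
  rw [integral_add ((h.memLp_process _).integrable one_le_two)
    ((h.memLp_noise i).integrable one_le_two), h.mean_process, h.integral_noise, add_zero]

lemma IsModel.indepFun_process_noise (h : IsModel P ξ ε μ σξ R σε) (z : Cube p) (i : Run no nc) :
    IndepFun (ξ z) (ε i) P :=
  h.indep_process_noise.comp (φ := fun a : Cube p → ℝ => a z) (ψ := fun b : Run no nc → ℝ => b i)
    (measurable_pi_apply _) (measurable_pi_apply _)

lemma IsModel.cov_noise (h : IsModel P ξ ε μ σξ R σε) (i j : Run no nc) :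
    covariance (ε i) (ε j) P = ((σε : ℝ) ^ 2 • (1 : Matrix (Run no nc) (Run no nc) ℝ)) i j := by
  rw [Matrix.smul_apply, Matrix.one_apply]
  split_ifs with hij
  · subst hij
    rw [covariance_self (h.measurable_noise i).aemeasurable]
    have := variance_map (X := fun t : ℝ => t) (Y := ε i) (μ := P) aemeasurable_id
      (h.measurable_noise i).aemeasurable
    rw [h.law_noise, variance_fun_id_gaussianReal] at this
    simpa [Function.comp_def] using this.symm
  · simpa using (h.indep_noise.indepFun hij).covariance_eq_zero (h.memLp_noise i) (h.memLp_noise j)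

lemma IsModel.cov_process_response (h : IsModel P ξ ε μ σξ R σε) (x : Run no nc → Cube p)
    (z : Cube p) (i : Run no nc) :
    covariance (ξ z) (response ξ ε x i) P = σξ ^ 2 * R z (x i) := by
  have hP := h.isProbabilityMeasure
  change covariance (ξ z) (ξ (x i) + ε i) P = _
  rw [covariance_add_right (h.memLp_process _) (h.memLp_process _) (h.memLp_noise _),
    h.cov_process, (h.indepFun_process_noise z i).covariance_eq_zero (h.memLp_process _)
      (h.memLp_noise _), add_zero]

lemma IsModel.cov_response_process (h : IsModel P ξ ε μ σξ R σε) (x : Run no nc → Cube p)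
    (z : Cube p) (i : Run no nc) :
    covariance (response ξ ε x i) (ξ z) P = crossCov σξ R x z i := by
  have hP := h.isProbabilityMeasure
  -- Symmetry of `σξ ^ 2 * R` is read off from symmetry of the covariance.
  rw [covariance_comm, h.cov_process_response, ← h.cov_process, covariance_comm, h.cov_process,
    crossCov]

lemma IsModel.cov_response (h : IsModel P ξ ε μ σξ R σε) (x : Run no nc → Cube p)
    (i j : Run no nc) :
    covariance (response ξ ε x i) (response ξ ε x j) P = covMatrix σξ R σε x i j := by
  have hP := h.isProbabilityMeasure
  change covariance (response ξ ε x i) (ξ (x j) + ε j) P = _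
  rw [covariance_add_right (h.memLp_response _ _) (h.memLp_process _) (h.memLp_noise _),
    h.cov_response_process]
  change _ + covariance (ξ (x i) + ε i) (ε j) P = _
  rw [covariance_add_left (h.memLp_process _) (h.memLp_noise _) (h.memLp_noise _),
    (h.indepFun_process_noise _ _).covariance_eq_zero (h.memLp_process _)
      (h.memLp_noise _), zero_add, h.cov_noise]
  simp [covMatrix, crossCov]

/-- The process part is a covariance matrix, hence positive semidefinite, and the noise adds a
positive multiple of the identity. -/
lemma IsModel.posDef_covMatrix (h : IsModel P ξ ε μ σξ R σε) (hσε : 0 < σε)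
    (x : Run no nc → Cube p) : (covMatrix σξ R σε x).PosDef := by
  have hP := h.isProbabilityMeasure
  refine Matrix.PosDef.posSemidef_add ?_ (Matrix.PosDef.one.smul (by positivity))
  refine posSemidef_of_covariance (fun i => h.memLp_process (x i)) fun i j => ?_
  rw [h.cov_process]
  rfl

end Covariance

/-! ### Linear prediction and its independent residuals. -/

section Residual

variable {p no nc : ℕ} {Ω : Type*} [MeasurableSpace Ω] {P : Measure Ω}
  {ξ : Cube p → Ω → ℝ} {ε : Run no nc → Ω → ℝ} {μ σξ : ℝ} {R : Cube p → Cube p → ℝ} {σε : ℝ≥0}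

/-- The matrix `Γ_{lo} Γ_{oo}⁻¹` of regression coefficients of the latent on the observed
responses. -/
noncomputable def latentCoeff (Γ : Matrix (Run no nc) (Run no nc) ℝ) :
    Matrix (Latent nc) (Fin no) ℝ :=
  Γ.toBlocks₂₁ * Γ.toBlocks₁₁⁻¹

/-- The part of the latent responses that the observed ones do not explain linearly. -/
noncomputable def latentResidual (Γ : Matrix (Run no nc) (Run no nc) ℝ) (ξ : Cube p → Ω → ℝ)
    (ε : Run no nc → Ω → ℝ) (x : Run no nc → Cube p) (l : Latent nc) (ω : Ω) : ℝ :=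
  response ξ ε x (Sum.inr l) ω - ∑ i, latentCoeff Γ l i * response ξ ε x (Sum.inl i) ω

/-- The residual of `ξ z` after linear prediction with coefficients `β` from all responses. -/
noncomputable def processResidual (β : Run no nc → ℝ) (ξ : Cube p → Ω → ℝ)
    (ε : Run no nc → Ω → ℝ) (x : Run no nc → Cube p) (z : Cube p) (ω : Ω) : ℝ :=
  ξ z ω - ∑ i, β i * response ξ ε x i ω

lemma covMatrix_mulVec_inv (h : IsModel P ξ ε μ σξ R σε) (hσε : 0 < σε) (x : Run no nc → Cube p)
    (v : Run no nc → ℝ) :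
    covMatrix σξ R σε x *ᵥ ((covMatrix σξ R σε x)⁻¹ *ᵥ v) = v := by
  rw [Matrix.mulVec_mulVec, Matrix.mul_nonsing_inv _
    ((Matrix.isUnit_iff_isUnit_det _).1 (h.posDef_covMatrix hσε x).isUnit), Matrix.one_mulVec]

/-- These are the normal equations; they make the latent residuals uncorrelated with the observed
responses. -/
lemma latentCoeff_mul (h : IsModel P ξ ε μ σξ R σε) (hσε : 0 < σε) (x : Run no nc → Cube p) :
    latentCoeff (covMatrix σξ R σε x) * (covMatrix σξ R σε x).toBlocks₁₁ =
      (covMatrix σξ R σε x).toBlocks₂₁ := by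
  have hpd : (covMatrix σξ R σε x).toBlocks₁₁.PosDef :=
    (h.posDef_covMatrix hσε x).submatrix (e := Sum.inl) Sum.inl_injective
  rw [latentCoeff, Matrix.mul_assoc, Matrix.nonsing_inv_mul _
    ((Matrix.isUnit_iff_isUnit_det _).1 hpd.isUnit), Matrix.mul_one]

lemma IsModel.memLp_latentResidual (h : IsModel P ξ ε μ σξ R σε) (x : Run no nc → Cube p)
    (Γ : Matrix (Run no nc) (Run no nc) ℝ) (l : Latent nc) :
    MemLp (latentResidual Γ ξ ε x l) 2 P :=
  (h.memLp_response x _).sub (memLp_finsetSum _ fun _ _ => (h.memLp_response x _).const_mul _)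

lemma IsModel.memLp_processResidual (h : IsModel P ξ ε μ σξ R σε) (x : Run no nc → Cube p)
    (β : Run no nc → ℝ) (z : Cube p) : MemLp (processResidual β ξ ε x z) 2 P :=
  (h.memLp_process z).sub (memLp_finsetSum _ fun _ _ => (h.memLp_response x _).const_mul _)

lemma IsModel.cov_latentResidual_response (h : IsModel P ξ ε μ σξ R σε) (x : Run no nc → Cube p)
    (Γ : Matrix (Run no nc) (Run no nc) ℝ) (l : Latent nc) (j : Run no nc) :
    covariance (latentResidual Γ ξ ε x l) (response ξ ε x j) P =
      covMatrix σξ R σε x (Sum.inr l) j -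
        ∑ i, latentCoeff Γ l i * covMatrix σξ R σε x (Sum.inl i) j := by
  have hP := h.isProbabilityMeasure
  have hm : ∀ i : Fin no, MemLp (fun ω => latentCoeff Γ l i * response ξ ε x (Sum.inl i) ω) 2 P :=
    fun i => (h.memLp_response x _).const_mul _
  change covariance (fun ω => response ξ ε x (Sum.inr l) ω -
    ∑ i, latentCoeff Γ l i * response ξ ε x (Sum.inl i) ω) (response ξ ε x j) P = _
  rw [covariance_fun_sub_left (h.memLp_response x _) (memLp_finsetSum _ fun i _ => hm i)
    (h.memLp_response x _), covariance_fun_sum_left hm (h.memLp_response x _)]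
  simp_rw [covariance_const_mul_left, h.cov_response]

lemma IsModel.cov_latentResidual_observed (h : IsModel P ξ ε μ σξ R σε) (hσε : 0 < σε)
    (x : Run no nc → Cube p) (l : Latent nc) (j : Fin no) :
    covariance (latentResidual (covMatrix σξ R σε x) ξ ε x l) (response ξ ε x (Sum.inl j)) P =
      0 := by
  rw [h.cov_latentResidual_response, sub_eq_zero]
  exact (congrFun (congrFun (latentCoeff_mul h hσε x) l) j).symm

/-- One residual is uncorrelated with the observed responses, so the other may be replaced by its
response, which leaves the Schur complement. -/
lemma IsModel.cov_latentResidual (h : IsModel P ξ ε μ σξ R σε) (hσε : 0 < σε)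
    (x : Run no nc → Cube p) (k l : Latent nc) :
    covariance (latentResidual (covMatrix σξ R σε x) ξ ε x k)
      (latentResidual (covMatrix σξ R σε x) ξ ε x l) P = latentCov (covMatrix σξ R σε x) k l := by
  have hP := h.isProbabilityMeasure
  set Γ := covMatrix σξ R σε x with hΓ
  have hm : ∀ i : Fin no, MemLp (fun ω => latentCoeff Γ l i * response ξ ε x (Sum.inl i) ω) 2 P :=
    fun i => (h.memLp_response x _).const_mul _
  change covariance (latentResidual Γ ξ ε x k) (fun ω => response ξ ε x (Sum.inr l) ω -
    ∑ i, latentCoeff Γ l i * response ξ ε x (Sum.inl i) ω) P = _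
  rw [covariance_fun_sub_right (h.memLp_latentResidual x Γ k) (h.memLp_response x _)
    (memLp_finsetSum _ fun i _ => hm i),
    covariance_fun_sum_right hm (h.memLp_latentResidual x Γ k)]
  simp_rw [covariance_const_mul_right, hΓ, h.cov_latentResidual_observed hσε,
    h.cov_latentResidual_response]
  simp [latentCov, latentCoeff, Matrix.mul_apply, Matrix.toBlocks₂₂, Matrix.toBlocks₁₂]

/-- The coefficients solve the normal equations `Γ β = γ`. -/
lemma IsModel.cov_processResidual_response (h : IsModel P ξ ε μ σξ R σε) (hσε : 0 < σε)
    (x : Run no nc → Cube p) (z : Cube p) (j : Run no nc) :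
    covariance (response ξ ε x j) (processResidual ((covMatrix σξ R σε x)⁻¹ *ᵥ crossCov σξ R x z)
      ξ ε x z) P = 0 := by
  have hP := h.isProbabilityMeasure
  set β := (covMatrix σξ R σε x)⁻¹ *ᵥ crossCov σξ R x z with hβ
  have hm : ∀ i, MemLp (fun ω => β i * response ξ ε x i ω) 2 P :=
    fun i => (h.memLp_response x _).const_mul _
  change covariance (response ξ ε x j) (fun ω => ξ z ω - ∑ i, β i * response ξ ε x i ω) P = _
  rw [covariance_fun_sub_right (h.memLp_response x _) (h.memLp_process z)
    (memLp_finsetSum _ fun i _ => hm i), covariance_fun_sum_right hm (h.memLp_response x _)]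
  simp_rw [covariance_const_mul_right, h.cov_response, h.cov_response_process]
  rw [sub_eq_zero, ← congrFun (covMatrix_mulVec_inv h hσε x (crossCov σξ R x z)) j]
  change ∑ i, covMatrix σξ R σε x j i * β i = _
  exact Finset.sum_congr rfl fun i _ => mul_comm _ _

lemma IsModel.variance_processResidual (h : IsModel P ξ ε μ σξ R σε) (hσε : 0 < σε)
    (x : Run no nc → Cube p) (z : Cube p) :
    variance (processResidual ((covMatrix σξ R σε x)⁻¹ *ᵥ crossCov σξ R x z) ξ ε x z) P =
      σξ ^ 2 - crossCov σξ R x z ⬝ᵥ ((covMatrix σξ R σε x)⁻¹ *ᵥ crossCov σξ R x z) := by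
  have hP := h.isProbabilityMeasure
  have h0 := h.cov_processResidual_response hσε x z
  set β := (covMatrix σξ R σε x)⁻¹ *ᵥ crossCov σξ R x z with hβ
  have hm : ∀ i, MemLp (fun ω => β i * response ξ ε x i ω) 2 P :=
    fun i => (h.memLp_response x _).const_mul _
  have hr := h.memLp_processResidual x β z
  rw [← covariance_self hr.aemeasurable]
  -- The residual is orthogonal to its own predictor, so only its covariance with `ξ z` remains.
  have e : covariance (processResidual β ξ ε x z) (fun ω => ξ z ω - ∑ i, β i * response ξ ε x i ω) P
      = covariance (processResidual β ξ ε x z) (ξ z) P := by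
    rw [covariance_fun_sub_right hr (h.memLp_process z) (memLp_finsetSum _ fun i _ => hm i),
      covariance_fun_sum_right hm hr]
    simp_rw [covariance_const_mul_right, covariance_comm (processResidual β ξ ε x z), h0]
    simp
  refine e.trans ?_
  change covariance (fun ω => ξ z ω - ∑ i, β i * response ξ ε x i ω) (ξ z) P = _
  rw [covariance_fun_sub_left (h.memLp_process z) (memLp_finsetSum _ fun i _ => hm i)
    (h.memLp_process z), covariance_fun_sum_left hm (h.memLp_process z), h.cov_process, h.corr_self]
  simp_rw [covariance_const_mul_left, h.cov_response_process]
  rw [dotProduct_comm, mul_one]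
  rfl

/-- Joint Gaussianity is what later turns vanishing covariances into independence. -/
lemma IsModel.hasGaussianLaw_residual (h : IsModel P ξ ε μ σξ R σε) (x : Run no nc → Cube p)
    (Γ : Matrix (Run no nc) (Run no nc) ℝ) (β : Run no nc → ℝ) (z : Cube p) :
    HasGaussianLaw (fun ω => ((fun i => response ξ ε x (Sum.inl i) ω,
      fun s => Sum.elim (latentResidual Γ ξ ε x) (fun _ => processResidual β ξ ε x z) s ω) :
        (Fin no → ℝ) × (Latent nc ⊕ Unit → ℝ))) P := by
  let L : (Run no nc → ℝ) × ℝ →ₗ[ℝ] (Fin no → ℝ) × (Latent nc ⊕ Unit → ℝ) :=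
    { toFun := fun q => (fun i => q.1 (Sum.inl i), Sum.elim
        (fun l => q.1 (Sum.inr l) - ∑ i, latentCoeff Γ l i * q.1 (Sum.inl i))
        (fun _ => q.2 - ∑ i, β i * q.1 i))
      map_add' := fun a b => by
        ext s
        · simp
        · rcases s with s | s <;>
            simp only [Prod.snd_add, Prod.fst_add, Pi.add_apply, Sum.elim_inl, Sum.elim_inr,
              mul_add, Finset.sum_add_distrib] <;> ring
      map_smul' := fun a b => by
        ext s
        · simp
        · rcases s with s | s <;>
            simp only [Prod.smul_snd, Prod.smul_fst, Pi.smul_apply, Sum.elim_inl, Sum.elim_inr,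
              smul_eq_mul, RingHom.id_apply, mul_sub, Finset.mul_sum, mul_left_comm] }
  have e := (h.hasGaussianLaw_response x z).map_fun L.toContinuousLinearMap
  refine e.congr (ae_of_all _ fun ω => Prod.ext rfl (funext fun s => ?_))
  rcases s with s | s <;> rfl

lemma IsModel.hasGaussianLaw_latentResidual (h : IsModel P ξ ε μ σξ R σε)
    (x : Run no nc → Cube p) (Γ : Matrix (Run no nc) (Run no nc) ℝ) :
    HasGaussianLaw (fun ω l => latentResidual Γ ξ ε x l ω) P := by
  -- The coefficients `0` and the point `fun _ => 0` are arbitrary, since the projection drops that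
  -- component.
  have hG := (h.hasGaussianLaw_residual x Γ 0 (fun _ => 0)).snd
  let L : (Latent nc ⊕ Unit → ℝ) →ₗ[ℝ] (Latent nc → ℝ) :=
    { toFun := fun q l => q (Sum.inl l)
      map_add' := fun _ _ => rfl
      map_smul' := fun _ _ => rfl }
  exact hG.map_fun L.toContinuousLinearMap

lemma IsModel.integral_latentResidual (h : IsModel P ξ ε μ σξ R σε)
    (x : Run no nc → Cube p) (Γ : Matrix (Run no nc) (Run no nc) ℝ) (l : Latent nc) :
    ∫ ω, latentResidual Γ ξ ε x l ω ∂P = μ - ∑ i, latentCoeff Γ l i * μ := by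
  have hP := h.isProbabilityMeasure
  have hi : ∀ i, Integrable (response ξ ε x i) P := fun i =>
    (h.memLp_response x i).integrable one_le_two
  simp only [latentResidual]
  rw [integral_sub (hi _) (integrable_finsetSum _ fun i _ => (hi _).const_mul _),
    integral_finsetSum _ fun i _ => (hi _).const_mul _]
  simp_rw [integral_const_mul, h.integral_response]

lemma IsModel.map_latentResidual (h : IsModel P ξ ε μ σξ R σε) (hσε : 0 < σε)
    (x : Run no nc → Cube p) (yo : Fin no → ℝ) :
    P.map (fun ω => WithLp.toLp 2 fun l => latentCoeff (covMatrix σξ R σε x) l ⬝ᵥ yo +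
      latentResidual (covMatrix σξ R σε x) ξ ε x l ω) = latentLaw (covMatrix σξ R σε x) μ yo := by
  have hP := h.isProbabilityMeasure
  have hr := h.memLp_latentResidual x (covMatrix σξ R σε x)
  have hi : ∀ l, Integrable (latentResidual (covMatrix σξ R σε x) ξ ε x l) P := fun l =>
    (hr l).integrable one_le_two
  have hG := (h.hasGaussianLaw_latentResidual x (covMatrix σξ R σε x)).toLp_pi 2
  refine map_eq_multivariateGaussian ?_ (fun l => ?_) fun k l => ?_
  · have := hG.isGaussian_map
    have e := AEMeasurable.map_map_of_aemeasurable (μ := P)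
      (f := fun ω => WithLp.toLp 2 fun l => latentResidual (covMatrix σξ R σε x) ξ ε x l ω)
      (g := fun w => WithLp.toLp 2 (fun l => latentCoeff (covMatrix σξ R σε x) l ⬝ᵥ yo) + w)
      (Measurable.aemeasurable (measurable_const_add _)) hG.aemeasurable
    refine ⟨?_⟩
    change IsGaussian (P.map ((fun w => WithLp.toLp 2
      (fun l => latentCoeff (covMatrix σξ R σε x) l ⬝ᵥ yo) + w) ∘
      (fun ω => WithLp.toLp 2 fun l => latentResidual (covMatrix σξ R σε x) ξ ε x l ω)))
    rw [← e]
    infer_instance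
  · rw [integral_add (integrable_const _) (hi l), h.integral_latentResidual]
    simp only [integral_const, probReal_univ, one_smul, latentMean, Matrix.mulVec_mulVec]
    change _ = μ + latentCoeff (covMatrix σξ R σε x) l ⬝ᵥ (fun i => yo i - μ)
    simp only [dotProduct, mul_sub, Finset.sum_sub_distrib]
    ring
  · rw [covariance_const_add_left (hi k), covariance_const_add_right (hi l)]
    exact h.cov_latentResidual hσε x k l

/-- Under the posterior given the observed responses, the latent responses have the law
`latentLaw` and are independent of the part of `ξ z` that they do not explain linearly. -/
theorem IsModel.map_posteriorObs_latent (h : IsModel P ξ ε μ σξ R σε) (hσε : 0 < σε)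
    (x : Run no nc → Cube p) (yo : Fin no → ℝ) (z : Cube p) {β : Run no nc → ℝ}
    (hβ : β = (covMatrix σξ R σε x)⁻¹ *ᵥ crossCov σξ R x z) :
    (posteriorObs P ξ σε (fun i => x (Sum.inl i)) yo).map
      (fun ω => ((WithLp.toLp 2 fun l => response ξ ε x (Sum.inr l) ω,
        ξ z ω - ∑ l, β (Sum.inr l) * response ξ ε x (Sum.inr l) ω) :
          EuclideanSpace ℝ (Latent nc) × ℝ)) =
      (latentLaw (covMatrix σξ R σε x) μ yo).prod
        (P.map fun ω => (∑ i, β (Sum.inl i) * yo i) + processResidual β ξ ε x z ω) := by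
  have hP := h.isProbabilityMeasure
  set Γ := covMatrix σξ R σε x with hΓ
  have hY := h.measurable_response x
  have hrm : ∀ l, Measurable (latentResidual Γ ξ ε x l) := fun l =>
    (hY _).sub (Finset.measurable_sum _ fun i _ => (hY _).const_mul _)
  have hsm : Measurable (processResidual β ξ ε x z) :=
    (h.measurable_process z).sub (Finset.measurable_sum _ fun i _ => (hY _).const_mul _)
  have hG := h.hasGaussianLaw_residual x Γ β z
  have hs0 : ∀ j, covariance (response ξ ε x j) (processResidual β ξ ε x z) P = 0 := fun j => by
    rw [hβ]
    exact h.cov_processResidual_response hσε x z j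
  have hind : IndepFun (fun ω i => response ξ ε x (Sum.inl i) ω)
      (fun ω (s : Latent nc ⊕ Unit) =>
        Sum.elim (latentResidual Γ ξ ε x) (fun _ => processResidual β ξ ε x z) s ω) P := by
    refine hG.indepFun_of_covariance_eval fun i s => ?_
    rcases s with s | s
    · rw [covariance_comm]
      exact h.cov_latentResidual_observed hσε x s i
    · exact hs0 _
  -- Each latent residual is a linear combination of responses, all of them uncorrelated with the
  -- process residual.
  have hind2 : IndepFun (fun ω l => latentResidual Γ ξ ε x l ω)
      (fun ω (_ : Unit) => processResidual β ξ ε x z ω) P := by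
    have hG2 : HasGaussianLaw (fun ω => ((fun l => latentResidual Γ ξ ε x l ω,
        fun _ => processResidual β ξ ε x z ω) : (Latent nc → ℝ) × (Unit → ℝ))) P := by
      let L : (Latent nc ⊕ Unit → ℝ) →ₗ[ℝ] (Latent nc → ℝ) × (Unit → ℝ) :=
        { toFun := fun q => (fun l => q (Sum.inl l), fun u => q (Sum.inr u))
          map_add' := fun _ _ => rfl
          map_smul' := fun _ _ => rfl }
      exact hG.snd.map_fun L.toContinuousLinearMap
    refine hG2.indepFun_of_covariance_eval (Y := fun _ => processResidual β ξ ε x z) fun l _ => ?_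
    have hm : ∀ i : Fin no, MemLp (fun ω => latentCoeff Γ l i * response ξ ε x (Sum.inl i) ω) 2 P :=
      fun i => (h.memLp_response x _).const_mul _
    change covariance (fun ω => response ξ ε x (Sum.inr l) ω -
      ∑ i, latentCoeff Γ l i * response ξ ε x (Sum.inl i) ω) (processResidual β ξ ε x z) P = 0
    rw [covariance_fun_sub_left (h.memLp_response x _) (memLp_finsetSum _ fun i _ => hm i)
      (h.memLp_processResidual x β z), covariance_fun_sum_left hm (h.memLp_processResidual x β z)]
    simp_rw [covariance_const_mul_left, hs0]
    simp
  -- `Φ` collects the linear predictors from the observed responses and `V` the two residuals.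
  -- Subtracting the latent part of the predictor from `ξ z` leaves its observed part plus the
  -- process residual.
  have key := h.map_posteriorObs_eq hσε x (E := EuclideanSpace ℝ (Latent nc) × ℝ)
    (g := fun q => (WithLp.toLp 2 fun l => q.1 (x (Sum.inr l)) + q.2 l,
      q.1 z - ∑ l, β (Sum.inr l) * (q.1 (x (Sum.inr l)) + q.2 l))) (by fun_prop)
    (Φ := fun y => (WithLp.toLp 2 fun l => latentCoeff Γ l ⬝ᵥ y, ∑ i, β (Sum.inl i) * y i))
    (by simp only [dotProduct]; fun_prop)
    (V := fun ω => (WithLp.toLp 2 fun l => latentResidual Γ ξ ε x l ω, processResidual β ξ ε x z ω))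
    (by fun_prop)
    (fun ω => by
      refine Prod.ext ?_ ?_
      · ext l
        simp [latentSource, latentResidual, dotProduct, response]
      · simp only [latentSource, processResidual, Prod.snd_add, Fintype.sum_sum_type (α₁ := Fin no),
          response]
        ring)
    (hind.comp (φ := id) (ψ := fun s : Latent nc ⊕ Unit → ℝ =>
      ((WithLp.toLp 2 fun l => s (Sum.inl l), s (Sum.inr ())) : EuclideanSpace ℝ (Latent nc) × ℝ))
      measurable_id (by fun_prop)) yo
  refine key.trans ?_
  have hind3 := hind2.comp (φ := fun w : Latent nc → ℝ => WithLp.toLp 2 fun l =>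
    latentCoeff Γ l ⬝ᵥ yo + w l) (ψ := fun s : Unit → ℝ => (∑ i, β (Sum.inl i) * yo i) + s ())
      (by fun_prop) (by fun_prop)
  have hprod := hind3.map_prod_eq_prod_map_map (Measurable.aemeasurable (by fun_prop))
    (Measurable.aemeasurable (by fun_prop))
  rw [← h.map_latentResidual hσε x yo]
  exact hprod

end Residual

/-! ### Conditioning under maps, products and partitions. -/

section Conditioning

variable {Ω Ω' : Type*} [MeasurableSpace Ω] [MeasurableSpace Ω']

lemma map_cond_preimage (μ : Measure Ω) {f : Ω → Ω'} (hf : Measurable f) {s : Set Ω'}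
    (hs : MeasurableSet s) :
    (ProbabilityTheory.cond μ (f ⁻¹' s)).map f = ProbabilityTheory.cond (μ.map f) s := by
  rw [ProbabilityTheory.cond, ProbabilityTheory.cond, Measure.map_smul, Measure.map_apply hf hs,
    Measure.restrict_map hf hs]

/-- Used to see that censoring, which concerns only the latent responses, leaves the independent
remainder untouched. -/
lemma cond_prod_univ (μ : Measure Ω) (ρ : Measure Ω') [SFinite μ] [IsProbabilityMeasure ρ]
    (s : Set Ω) :
    ProbabilityTheory.cond (μ.prod ρ) (s ×ˢ Set.univ) = (ProbabilityTheory.cond μ s).prod ρ := by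
  rw [ProbabilityTheory.cond, ProbabilityTheory.cond, Measure.prod_prod, measure_univ, mul_one,
    Measure.prod_smul_left, ← Measure.prod_restrict, Measure.restrict_univ]

lemma memLp_cond {μ : Measure Ω} {s : Set Ω} (hs : μ s ≠ 0) {f : Ω → ℝ} {q : ℝ≥0∞}
    (hf : MemLp f q μ) : MemLp f q (ProbabilityTheory.cond μ s) :=
  (hf.restrict s).smul_measure (ENNReal.inv_ne_top.2 hs)

lemma cond_eq_add_of_disjoint {μ : Measure Ω} [IsFiniteMeasure μ] {s u v : Set Ω}
    (hv : MeasurableSet v) (hdis : Disjoint u v)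
    (hsuv : s = u ∪ v) (hu0 : μ u ≠ 0) (hv0 : μ v ≠ 0) :
    ProbabilityTheory.cond μ s = (μ u / μ s) • ProbabilityTheory.cond μ u +
      (μ v / μ s) • ProbabilityTheory.cond μ v := by
  have e : ∀ {w : Set Ω}, μ w ≠ 0 → (μ w / μ s) • ProbabilityTheory.cond μ w =
      (μ s)⁻¹ • μ.restrict w := fun {w} hw => by
    rw [ProbabilityTheory.cond, smul_smul, ENNReal.div_eq_inv_mul, mul_assoc,
      ENNReal.mul_inv_cancel hw (measure_ne_top _ _), mul_one]
  rw [e hu0, e hv0, ← smul_add, ← Measure.restrict_union hdis hv, ← hsuv, ProbabilityTheory.cond]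

end Conditioning

/-! ### Transfer of conditional expectations and the law of total covariance. -/

section TotalCovariance

variable {Ω Ω' : Type*} {m m₀ : MeasurableSpace Ω} [MeasurableSpace Ω']

/-- By change of variables in the defining integrals. It moves the computation from the sample space
to the space of latent responses. -/
lemma condExp_map {Q : Measure Ω'} [IsFiniteMeasure Q] {W : Ω' → Ω} (hW : Measurable W)
    (hm : m ≤ m₀) {X : Ω → ℝ} (hX : Integrable X (Q.map W)) :
    condExp (m.comap W) Q (X ∘ W) =ᵐ[Q] condExp m (Q.map W) X ∘ W := by
  have hle : m.comap W ≤ (inferInstance : MeasurableSpace Ω') :=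
    (MeasurableSpace.comap_mono hm).trans hW.comap_le
  have hce : Integrable (condExp m (Q.map W) X ∘ W) Q :=
    integrable_condExp.comp_measurable hW
  refine (ae_eq_condExp_of_forall_setIntegral_eq hle (hX.comp_measurable hW)
    (fun _ _ _ => hce.integrableOn) ?_ ?_).symm
  · rintro _ ⟨s, hs, rfl⟩ -
    have h1 := setIntegral_map (μ := Q) (hm s hs) (f := condExp m (Q.map W) X)
      integrable_condExp.aestronglyMeasurable hW.aemeasurable
    have h2 := setIntegral_map (μ := Q) (hm s hs) (f := X) hX.aestronglyMeasurable hW.aemeasurable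
    simp only [Function.comp_apply]
    rw [← h1, ← h2, setIntegral_condExp hm hX hs]
  · refine StronglyMeasurable.aestronglyMeasurable ?_
    exact stronglyMeasurable_condExp.comp_measurable (comap_measurable W)

lemma integral_mul_condExp {τ : Measure Ω} [IsFiniteMeasure τ]
    (hm : m ≤ m₀) {X Y : Ω → ℝ} (hX : MemLp X 2 τ) (hY : MemLp Y 2 τ) :
    ∫ ω, X ω * condExp m τ Y ω ∂τ = ∫ ω, condExp m τ X ω * condExp m τ Y ω ∂τ := by
  have hY' : MemLp (condExp m τ Y) 2 τ := hY.condExp one_le_two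
  rw [← integral_condExp hm (f := fun ω => X ω * condExp m τ Y ω)]
  exact integral_congr_ae (condExp_mul_of_stronglyMeasurable_right stronglyMeasurable_condExp
    (hX.integrable_mul hY') (hX.integrable one_le_two))

lemma covariance_congr_ae {τ : Measure Ω} {X X' Y Y' : Ω → ℝ} (hX : X =ᵐ[τ] X')
    (hY : Y =ᵐ[τ] Y') : covariance X Y τ = covariance X' Y' τ := by
  rw [covariance, covariance, integral_congr_ae hX, integral_congr_ae hY]
  refine integral_congr_ae ?_
  filter_upwards [hX, hY] with ω h1 h2
  rw [h1, h2]

/-- **Law of total covariance**. -/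
lemma integral_condCov_add_covariance_condExp {τ : Measure Ω} [IsProbabilityMeasure τ]
    (hm : m ≤ m₀) {X Y : Ω → ℝ} (hX : MemLp X 2 τ) (hY : MemLp Y 2 τ) :
    (∫ ω, condCov m X Y τ ω ∂τ) + covariance (condExp m τ X) (condExp m τ Y) τ =
      covariance X Y τ := by
  have hX' : MemLp (condExp m τ X) 2 τ := hX.condExp one_le_two
  have hY' : MemLp (condExp m τ Y) 2 τ := hY.condExp one_le_two
  have e1 := integral_mul_condExp hm hX hY
  have e2 := integral_mul_condExp hm hY hX
  rw [condCov, integral_condExp hm, covariance_eq_sub hX' hY', covariance_eq_sub hX hY,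
    integral_condExp hm, integral_condExp hm]
  -- After expansion both mixed terms equal the integral of the product of the conditional
  -- expectations, by `e1` and `e2`.
  have e : ∫ ω, ((X - condExp m τ X) * (Y - condExp m τ Y)) ω ∂τ =
      ∫ ω, X ω * Y ω ∂τ - ∫ ω, condExp m τ X ω * condExp m τ Y ω ∂τ := by
    have : ∀ ω, ((X - condExp m τ X) * (Y - condExp m τ Y)) ω = (X ω * Y ω - X ω * condExp m τ Y ω)
        - (Y ω * condExp m τ X ω - condExp m τ X ω * condExp m τ Y ω) := fun ω => by
      simp only [Pi.mul_apply, Pi.sub_apply]; ring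
    have i1 : Integrable (fun ω => X ω * Y ω) τ := hX.integrable_mul hY
    have i2 : Integrable (fun ω => X ω * condExp m τ Y ω) τ := hX.integrable_mul hY'
    have i3 : Integrable (fun ω => Y ω * condExp m τ X ω) τ := hY.integrable_mul hX'
    have i4 : Integrable (fun ω => condExp m τ X ω * condExp m τ Y ω) τ := hX'.integrable_mul hY'
    have k1 := integral_sub (i1.sub i2) (i3.sub i4)
    simp only [Pi.sub_apply] at k1
    simp_rw [this]
    rw [k1, integral_sub i1 i2, integral_sub i3 i4, e1, e2]
    simp_rw [mul_comm (condExp m τ Y _)]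
    ring
  rw [e]
  simp only [Pi.mul_apply]
  ring

/-- The factor `X - condExp m τ X` vanishes. This accounts for the zero row of `Σ̂` at the new run;
the version on the right accounts for the column. -/
lemma condCov_eq_zero_of_left {τ : Measure Ω} [IsFiniteMeasure τ]
    (hm : m ≤ m₀) {X Y : Ω → ℝ} (hX : StronglyMeasurable[m] X) (hXi : Integrable X τ) :
    condCov m X Y τ = 0 := by
  simp [condCov, condExp_of_stronglyMeasurable hm hX hXi]

lemma condCov_eq_zero_of_right {τ : Measure Ω} [IsFiniteMeasure τ]
    (hm : m ≤ m₀) {X Y : Ω → ℝ} (hY : StronglyMeasurable[m] Y) (hYi : Integrable Y τ) :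
    condCov m X Y τ = 0 := by
  simp [condCov, condExp_of_stronglyMeasurable hm hY hYi]

end TotalCovariance

/-! ### Conditional expectation given a censored variable. -/

section Censoring

lemma censor_eq_min (c y : ℝ) : censor c y = min c y := by
  simp only [censor, min_def]

lemma measurable_censor (c : ℝ) : Measurable (censor c) := by
  have : censor c = fun y => min c y := funext (censor_eq_min c)
  rw [this]
  fun_prop

variable {E : Type*} [MeasurableSpace E] {τ₀ τ₁ : Measure E} [IsProbabilityMeasure τ₀]
  [IsProbabilityMeasure τ₁] {a b : ℝ≥0∞} {c : ℝ} {t : E → ℝ} {X Y : E → ℝ}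

/-- A version of the conditional expectation of `X` given the censored variable, under a mixture of
a law `τ₁` carried by the censored region and a law `τ₀` carried by the uncensored one. -/
noncomputable def censoredCondExp (τ₀ τ₁ : Measure E) (c : ℝ) (t X : E → ℝ) (w : E) : ℝ :=
  if t w < c then condExp (MeasurableSpace.comap t inferInstance) τ₀ X w else ∫ w, X w ∂τ₁

omit [IsProbabilityMeasure τ₀] [IsProbabilityMeasure τ₁] in
lemma censoredCondExp_ae_above (h₁ : ∀ᵐ w ∂τ₁, c ≤ t w) :
    censoredCondExp τ₀ τ₁ c t X =ᵐ[τ₁] fun _ => ∫ w, X w ∂τ₁ := by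
  filter_upwards [h₁] with w hw
  rw [censoredCondExp, if_neg hw.not_gt]

omit [IsProbabilityMeasure τ₀] [IsProbabilityMeasure τ₁] in
lemma censoredCondExp_ae_below (h₀ : ∀ᵐ w ∂τ₀, t w < c) :
    censoredCondExp τ₀ τ₁ c t X =ᵐ[τ₀]
      condExp (MeasurableSpace.comap t inferInstance) τ₀ X := by
  filter_upwards [h₀] with w hw
  rw [censoredCondExp, if_pos hw]

-- The condition `t w < c` says that the censored value is below `c`, and there it equals `t w`.
-- Writing the conditional expectation as `f ∘ t` therefore factors the whole function through the
-- censored variable.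
omit [IsProbabilityMeasure τ₀] [IsProbabilityMeasure τ₁] in
lemma stronglyMeasurable_censoredCondExp :
    StronglyMeasurable[MeasurableSpace.comap (fun w => censor c (t w)) inferInstance]
      (censoredCondExp τ₀ τ₁ c t X) := by
  obtain ⟨f, hf, hfe⟩ := (stronglyMeasurable_condExp (m := MeasurableSpace.comap t inferInstance)
    (μ := τ₀) (f := X)).exists_eq_measurable_comp
  have e : censoredCondExp τ₀ τ₁ c t X =
      (fun y => if y < c then f y else ∫ w, X w ∂τ₁) ∘ fun w => censor c (t w) := by
    funext w
    simp only [censoredCondExp, Function.comp_apply, censor_eq_min, hfe]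
    by_cases hw : t w < c
    · simp [hw, hw.le]
    · simp [hw, not_lt.1 hw]
  rw [e]
  refine (StronglyMeasurable.ite measurableSet_Iio hf stronglyMeasurable_const).comp_measurable
    (comap_measurable _)

omit [IsProbabilityMeasure τ₀] in
lemma memLp_censoredCondExp_above (h₁ : ∀ᵐ w ∂τ₁, c ≤ t w) :
    MemLp (censoredCondExp τ₀ τ₁ c t X) 2 τ₁ :=
  (memLp_congr_ae (censoredCondExp_ae_above h₁)).2 (memLp_const _)

omit [IsProbabilityMeasure τ₀] [IsProbabilityMeasure τ₁] in
lemma memLp_censoredCondExp_below (h₀ : ∀ᵐ w ∂τ₀, t w < c) (hX : MemLp X 2 τ₀) :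
    MemLp (censoredCondExp τ₀ τ₁ c t X) 2 τ₀ :=
  (memLp_congr_ae (censoredCondExp_ae_below h₀)).2 (hX.condExp one_le_two)

omit [IsProbabilityMeasure τ₀] [IsProbabilityMeasure τ₁] in
lemma memLp_mixture (ha : a ≠ ∞) (hb : b ≠ ∞) (h₁ : MemLp X 2 τ₁) (h₀ : MemLp X 2 τ₀) :
    MemLp X 2 (a • τ₁ + b • τ₀) := by
  refine (memLp_two_iff_integrable_sq ((h₁.smul_measure ha).1.add_measure
    (h₀.smul_measure hb).1)).2 ?_
  exact (h₁.smul_measure ha).integrable_sq.add_measure (h₀.smul_measure hb).integrable_sq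

omit [IsProbabilityMeasure τ₀] [IsProbabilityMeasure τ₁] in
lemma integral_mixture (ha : a ≠ ∞) (hb : b ≠ ∞) (h₁ : Integrable X τ₁) (h₀ : Integrable X τ₀) :
    ∫ w, X w ∂(a • τ₁ + b • τ₀) = a.toReal * ∫ w, X w ∂τ₁ + b.toReal * ∫ w, X w ∂τ₀ := by
  rw [integral_add_measure (h₁.smul_measure ha) (h₀.smul_measure hb), integral_smul_measure,
    integral_smul_measure, smul_eq_mul, smul_eq_mul]

/-- The defining integrals are checked separately on the two components, because `censor c ∘ t` is
almost surely `c` under `τ₁` and almost surely `t` under `τ₀`. -/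
lemma condExp_censor_mixture (ha : a ≠ ∞) (hb : b ≠ ∞) (ht : Measurable t)
    (h₁ : ∀ᵐ w ∂τ₁, c ≤ t w) (h₀ : ∀ᵐ w ∂τ₀, t w < c) (hX₁ : MemLp X 2 τ₁) (hX₀ : MemLp X 2 τ₀) :
    censoredCondExp τ₀ τ₁ c t X =ᵐ[a • τ₁ + b • τ₀]
      condExp (MeasurableSpace.comap (fun w => censor c (t w)) inferInstance)
        (a • τ₁ + b • τ₀) X := by
  have hct : Measurable fun w => censor c (t w) := (measurable_censor c).comp ht
  have hfin : IsFiniteMeasure (a • τ₁ + b • τ₀) := by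
    have := Measure.smul_finite τ₁ ha
    have := Measure.smul_finite τ₀ hb
    infer_instance
  have hG₁ := memLp_censoredCondExp_above (τ₀ := τ₀) (X := X) h₁
  have hG₀ := memLp_censoredCondExp_below (τ₁ := τ₁) h₀ hX₀
  refine ae_eq_condExp_of_forall_setIntegral_eq hct.comap_le
    ((memLp_mixture ha hb hX₁ hX₀).integrable one_le_two)
    (fun _ _ _ => ((memLp_mixture ha hb hG₁ hG₀).integrable one_le_two).integrableOn) ?_
    stronglyMeasurable_censoredCondExp.aestronglyMeasurable
  rintro _ ⟨B, hB, rfl⟩ -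
  have hs : MeasurableSet ((fun w => censor c (t w)) ⁻¹' B) := hct hB
  have hsplit : ∀ {F : E → ℝ}, Integrable F τ₁ → Integrable F τ₀ →
      ∫ w in (fun w => censor c (t w)) ⁻¹' B, F w ∂(a • τ₁ + b • τ₀) =
        a.toReal * ∫ w in (fun w => censor c (t w)) ⁻¹' B, F w ∂τ₁ +
          b.toReal * ∫ w in (fun w => censor c (t w)) ⁻¹' B, F w ∂τ₀ := by
    intro F hF₁ hF₀
    rw [Measure.restrict_add, Measure.restrict_smul, Measure.restrict_smul, integral_add_measure
      (hF₁.integrableOn.smul_measure ha) (hF₀.integrableOn.smul_measure hb), integral_smul_measure,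
      integral_smul_measure, smul_eq_mul, smul_eq_mul]
  rw [hsplit (hG₁.integrable one_le_two) (hG₀.integrable one_le_two),
    hsplit (hX₁.integrable one_le_two) (hX₀.integrable one_le_two)]
  congr 2
  · rw [setIntegral_congr_ae hs ((censoredCondExp_ae_above h₁).mono fun w hw _ => hw)]
    -- Under `τ₁` the event is full or null according to whether `c ∈ B`, so only the mean of `X`
    -- matters.
    by_cases hc : c ∈ B
    · have hu : (fun w => censor c (t w)) ⁻¹' B =ᵐ[τ₁] Set.univ := by
        filter_upwards [h₁] with w hw
        refine propext ⟨fun _ => trivial, fun _ => ?_⟩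
        change censor c (t w) ∈ B
        rwa [censor_eq_min, min_eq_left hw]
      rw [setIntegral_congr_set hu, setIntegral_congr_set hu]
      simp
    · have hu : (fun w => censor c (t w)) ⁻¹' B =ᵐ[τ₁] (∅ : Set E) := by
        filter_upwards [h₁] with w hw
        refine propext ⟨fun h => hc ?_, fun h => h.elim⟩
        change censor c (t w) ∈ B at h
        rwa [censor_eq_min, min_eq_left hw] at h
      rw [setIntegral_congr_set hu, setIntegral_congr_set hu]
      simp
  · rw [setIntegral_congr_ae hs ((censoredCondExp_ae_below h₀).mono fun w hw _ => hw)]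
    -- Under `τ₀` nothing is censored, and the event belongs to the σ-algebra of `t`.
    have hu : (fun w => censor c (t w)) ⁻¹' B =ᵐ[τ₀] t ⁻¹' B := by
      filter_upwards [h₀] with w hw
      refine propext ?_
      change censor c (t w) ∈ B ↔ t w ∈ B
      rw [censor_eq_min, min_eq_right hw.le]
    rw [setIntegral_congr_set hu, setIntegral_congr_set hu]
    exact setIntegral_condExp ht.comap_le (hX₀.integrable one_le_two) ⟨B, hB, rfl⟩

/-- The covariance of the conditional expectations given a censored variable. -/
theorem covariance_condExp_censor (ha : a ≠ ∞) (hb : b ≠ ∞)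
    (hab : b.toReal = 1 - a.toReal) [IsProbabilityMeasure (a • τ₁ + b • τ₀)] (ht : Measurable t)
    (h₁ : ∀ᵐ w ∂τ₁, c ≤ t w) (h₀ : ∀ᵐ w ∂τ₀, t w < c) (hX₁ : MemLp X 2 τ₁) (hX₀ : MemLp X 2 τ₀)
    (hY₁ : MemLp Y 2 τ₁) (hY₀ : MemLp Y 2 τ₀) :
    covariance
      (condExp (MeasurableSpace.comap (fun w => censor c (t w)) inferInstance) (a • τ₁ + b • τ₀) X)
      (condExp (MeasurableSpace.comap (fun w => censor c (t w)) inferInstance) (a • τ₁ + b • τ₀) Y)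
      (a • τ₁ + b • τ₀) =
    (1 - a.toReal) * (covariance X Y τ₀ -
      ∫ w, condCov (MeasurableSpace.comap t inferInstance) X Y τ₀ w ∂τ₀) +
    a.toReal * (1 - a.toReal) * ((∫ w, X w ∂τ₁ - ∫ w, X w ∂τ₀) * (∫ w, Y w ∂τ₁ - ∫ w, Y w ∂τ₀)) := by
  have hGX₁ := memLp_censoredCondExp_above (τ₀ := τ₀) (X := X) h₁
  have hGX₀ := memLp_censoredCondExp_below (τ₁ := τ₁) h₀ hX₀
  have hGY₁ := memLp_censoredCondExp_above (τ₀ := τ₀) (X := Y) h₁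
  have hGY₀ := memLp_censoredCondExp_below (τ₁ := τ₁) h₀ hY₀
  have eX := condExp_censor_mixture ha hb ht h₁ h₀ hX₁ hX₀
  have eY := condExp_censor_mixture ha hb ht h₁ h₀ hY₁ hY₀
  have hmean : ∀ {Z : E → ℝ}, MemLp Z 2 τ₁ → MemLp Z 2 τ₀ →
      ∫ w, censoredCondExp τ₀ τ₁ c t Z w ∂(a • τ₁ + b • τ₀) =
        a.toReal * ∫ w, Z w ∂τ₁ + b.toReal * ∫ w, Z w ∂τ₀ := by
    intro Z hZ₁ hZ₀
    rw [integral_mixture ha hb ((memLp_censoredCondExp_above h₁).integrable one_le_two)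
      ((memLp_censoredCondExp_below h₀ hZ₀).integrable one_le_two),
      integral_congr_ae (censoredCondExp_ae_above h₁),
      integral_congr_ae (censoredCondExp_ae_below h₀), integral_condExp ht.comap_le]
    simp
  -- The within-component term becomes the covariance under `τ₀` of the conditional expectations
  -- given `t`; what remains is the algebra of a two-component mixture, in which the means
  -- contribute `a (1 - a)` times the product of their gaps.
  rw [← integral_condCov_add_covariance_condExp ht.comap_le hX₀ hY₀,
    ← covariance_congr_ae eX eY,
    covariance_eq_sub (memLp_mixture ha hb hGX₁ hGX₀) (memLp_mixture ha hb hGY₁ hGY₀),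
    covariance_eq_sub (hX₀.condExp one_le_two) (hY₀.condExp one_le_two),
    hmean hX₁ hX₀, hmean hY₁ hY₀, integral_condExp ht.comap_le, integral_condExp ht.comap_le]
  rw [integral_mixture ha hb (hGX₁.integrable_mul hGY₁) (hGX₀.integrable_mul hGY₀),
    integral_congr_ae ((censoredCondExp_ae_above h₁).mul (censoredCondExp_ae_above h₁)),
    integral_congr_ae ((censoredCondExp_ae_below h₀).mul (censoredCondExp_ae_below h₀)), hab]
  simp only [Pi.mul_apply, integral_const, probReal_univ, one_smul]
  ring

end Censoring

/-! ### Positive probability of boxes of responses. -/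

section Positivity

variable {p no nc : ℕ} {Ω : Type*} [MeasurableSpace Ω] {P : Measure Ω}
  {ξ : Cube p → Ω → ℝ} {ε : Run no nc → Ω → ℝ} {μ σξ : ℝ} {R : Cube p → Cube p → ℝ} {σε : ℝ≥0}

/-- By the noise, the responses charge every box whose sides have positive length. -/
lemma IsModel.measure_response_mem_ne_zero (h : IsModel P ξ ε μ σξ R σε) (hσε : 0 < σε)
    (x : Run no nc → Cube p) {I : Run no nc → Set ℝ} (hI : ∀ i, MeasurableSet (I i))
    (hI0 : ∀ i, volume (I i) ≠ 0) : P {ω | ∀ i, response ξ ε x i ω ∈ I i} ≠ 0 := by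
  have hP := h.isProbabilityMeasure
  have hv : σε ^ 2 ≠ 0 := (pow_pos hσε 2).ne'
  have hA : Measurable fun ω z => ξ z ω := measurable_pi_lambda _ h.measurable_process
  have hE : Measurable fun ω i => ε i ω := measurable_pi_lambda _ h.measurable_noise
  have hlaw : P.map (fun ω i => ε i ω) = Measure.pi fun _ => gaussianReal 0 (σε ^ 2) := by
    have := h.indep_noise.map_fun_eq_pi_map (fun i => (h.measurable_noise i).aemeasurable)
    simp_rw [h.law_noise] at this
    exact this
  have hprod := h.indep_process_noise.map_prod_eq_prod_map_map hA.aemeasurable hE.aemeasurable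
  have hpA := Measure.isProbabilityMeasure_map (μ := P) hA.aemeasurable
  have hset : MeasurableSet {q : (Cube p → ℝ) × (Run no nc → ℝ) | ∀ i, q.1 (x i) + q.2 i ∈ I i} := by
    rw [Set.ofPred_forall]
    refine MeasurableSet.iInter fun i => ?_
    exact measurableSet_preimage (f := fun q : (Cube p → ℝ) × (Run no nc → ℝ) => q.1 (x i) + q.2 i)
      (by fun_prop) (hI i)
  have e : P {ω | ∀ i, response ξ ε x i ω ∈ I i} =
      ((P.map fun ω z => ξ z ω).prod (Measure.pi fun _ => gaussianReal 0 (σε ^ 2)))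
        {q : (Cube p → ℝ) × (Run no nc → ℝ) | ∀ i, q.1 (x i) + q.2 i ∈ I i} := by
    rw [← hlaw, ← hprod, Measure.map_apply (hA.prodMk hE) hset]
    rfl
  rw [e, Ne, Measure.measure_prod_null hset]
  intro h0
  -- For a fixed path the noise must fall in a translated box. Its probability is a product of
  -- nonzero factors, because Lebesgue measure is absolutely continuous with respect to the
  -- nondegenerate Gaussian.
  have hfalse : ∀ᵐ a ∂(P.map fun ω z => ξ z ω), False := by
    filter_upwards [h0] with a ha
    have ep : Prod.mk a ⁻¹' {q : (Cube p → ℝ) × (Run no nc → ℝ) | ∀ i, q.1 (x i) + q.2 i ∈ I i} =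
        Set.univ.pi fun i => (fun u => a (x i) + u) ⁻¹' I i := by
      ext u
      simp
    rw [ep, Measure.pi_pi, Pi.zero_apply, Finset.prod_eq_zero_iff] at ha
    obtain ⟨i, -, hi⟩ := ha
    rw [← Measure.map_apply (measurable_const_add _) (hI i), gaussianReal_map_const_add] at hi
    exact hI0 i (gaussianReal_absolutelyContinuous' _ hv hi)
  exact (NeZero.ne (P.map fun ω z => ξ z ω))
    (ae_eq_bot.1 (Filter.eventually_false_iff_eq_bot.1 hfalse))

end Positivity

/-! ### Truncated laws of the latent responses and the matrix `H_c`. -/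

section Truncation

variable {nc : ℕ}

/-- The region where the censored responses exceed the limit. -/
abbrev censoredRegion (nc : ℕ) (c : ℝ) : Set (EuclideanSpace ℝ (Latent nc)) :=
  {w | ∀ j : Fin nc, c ≤ w (Sum.inl j)}

/-- The part of the censored region where the new response exceeds the limit. -/
abbrev regionAbove (nc : ℕ) (c : ℝ) : Set (EuclideanSpace ℝ (Latent nc)) :=
  {w | (∀ j : Fin nc, c ≤ w (Sum.inl j)) ∧ c ≤ w (Sum.inr ())}

/-- The part of the censored region where the new response is below the limit. -/
abbrev regionBelow (nc : ℕ) (c : ℝ) : Set (EuclideanSpace ℝ (Latent nc)) :=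
  {w | (∀ j : Fin nc, c ≤ w (Sum.inl j)) ∧ w (Sum.inr ()) < c}

lemma measurableSet_censoredRegion (c : ℝ) : MeasurableSet (censoredRegion nc c) := by
  rw [censoredRegion, Set.ofPred_forall]
  exact MeasurableSet.iInter fun j => measurableSet_le measurable_const
    (f := fun _ => c) (g := fun w : EuclideanSpace ℝ (Latent nc) => w (Sum.inl j)) (by fun_prop)

lemma measurableSet_regionAbove (c : ℝ) : MeasurableSet (regionAbove nc c) :=
  (measurableSet_censoredRegion c).inter (measurableSet_le (f := fun _ => c)
    (g := fun w : EuclideanSpace ℝ (Latent nc) => w (Sum.inr ())) measurable_const (by fun_prop))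

lemma measurableSet_regionBelow (c : ℝ) : MeasurableSet (regionBelow nc c) :=
  (measurableSet_censoredRegion c).inter (measurableSet_lt
    (f := fun w : EuclideanSpace ℝ (Latent nc) => w (Sum.inr ())) (g := fun _ => c)
    (by fun_prop) measurable_const)

lemma censoredRegion_eq_union (c : ℝ) :
    censoredRegion nc c = regionAbove nc c ∪ regionBelow nc c := by
  ext w
  constructor
  · intro hw
    rcases le_or_gt c (w (Sum.inr ())) with h | h
    · exact Or.inl ⟨hw, h⟩
    · exact Or.inr ⟨hw, h⟩
  · rintro (hw | hw)
    · exact hw.1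
    · exact hw.1

lemma disjoint_regionAbove_regionBelow (c : ℝ) :
    Disjoint (regionAbove nc c) (regionBelow nc c) :=
  Set.disjoint_left.2 fun _ h₁ h₀ => (h₀.2.not_ge h₁.2).elim

lemma forall_latent_le_eq (c : ℝ) :
    {w : EuclideanSpace ℝ (Latent nc) | ∀ l, c ≤ w l} = regionAbove nc c := by
  ext w
  constructor
  · exact fun hw => ⟨fun j => hw _, hw _⟩
  · rintro hw (j | u)
    · exact hw.1 j
    · exact hw.2

variable (no : ℕ) {ν : Measure (EuclideanSpace ℝ (Latent nc))} [IsProbabilityMeasure ν] {c : ℝ}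

omit [IsProbabilityMeasure ν] in
lemma toReal_above_div (c : ℝ) :
    (ν (regionAbove nc c) / ν (censoredRegion nc c)).toReal = censProb ν c := by
  rw [ENNReal.toReal_div, censProb, forall_latent_le_eq]
  rfl

lemma toReal_below_div (h : ν (regionAbove nc c) ≠ 0) :
    (ν (regionBelow nc c) / ν (censoredRegion nc c)).toReal =
      1 - (ν (regionAbove nc c) / ν (censoredRegion nc c)).toReal := by
  have hs : ν (censoredRegion nc c) = ν (regionAbove nc c) + ν (regionBelow nc c) := by
    rw [censoredRegion_eq_union, measure_union (disjoint_regionAbove_regionBelow c)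
      (measurableSet_regionBelow c)]
  have hs0 : ν.real (censoredRegion nc c) ≠ 0 := by
    refine (ENNReal.toReal_pos ?_ (measure_ne_top _ _)).ne'
    rw [hs]
    exact fun h0 => h (add_eq_zero.1 h0).1
  rw [ENNReal.toReal_div, ENNReal.toReal_div, eq_sub_iff_add_eq, ← add_div,
    ← ENNReal.toReal_add (measure_ne_top _ _) (measure_ne_top _ _), add_comm, ← hs]
  exact div_self hs0

/-- Covers all pairs of latent indices at once: the entries involving the new run vanish because
that response is measurable for the conditioning σ-algebra. -/
lemma integral_condCov_truncBelow (hν : ∀ l, MemLp (fun w => w l) 2 ν)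
    (h₀ : ν (regionBelow nc c) ≠ 0) (k l : Latent nc) :
    ∫ w, condCov (MeasurableSpace.comap
      (fun w : EuclideanSpace ℝ (Latent nc) => w (Sum.inr ())) inferInstance)
      (fun w => w k) (fun w => w l) (truncBelow ν c) w ∂(truncBelow ν c) =
    sigmaHat no ν c (Sum.inr k) (Sum.inr l) := by
  have hτ : IsProbabilityMeasure (truncBelow ν c) := cond_isProbabilityMeasure h₀
  have hle : MeasurableSpace.comap
      (fun w : EuclideanSpace ℝ (Latent nc) => w (Sum.inr ())) inferInstance ≤
      (inferInstance : MeasurableSpace (EuclideanSpace ℝ (Latent nc))) :=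
    Measurable.comap_le (by fun_prop)
  have hi : ∀ l, Integrable (fun w => w l) (truncBelow ν c) := fun l =>
    (memLp_cond h₀ (hν l)).integrable one_le_two
  have hnew : StronglyMeasurable[MeasurableSpace.comap
      (fun w : EuclideanSpace ℝ (Latent nc) => w (Sum.inr ())) inferInstance]
      fun w : EuclideanSpace ℝ (Latent nc) => w (Sum.inr ()) :=
    (comap_measurable _).stronglyMeasurable
  rcases k with k | ⟨⟩
  · rcases l with l | ⟨⟩
    · rfl
    · rw [condCov_eq_zero_of_right hle hnew (hi _)]
      simp [sigmaHat]
  · rw [condCov_eq_zero_of_left hle hnew (hi _)]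
    rcases l with l | ⟨⟩ <;> simp [sigmaHat]

/-- `H_c` is the covariance matrix of the conditional expectations of the latent responses given
the new response after censoring. -/
lemma covariance_condExp_eq_Hc (hν : ∀ l, MemLp (fun w => w l) 2 ν)
    (h₁ : ν (regionAbove nc c) ≠ 0) (h₀ : ν (regionBelow nc c) ≠ 0) (k l : Latent nc) :
    covariance
      (condExp (MeasurableSpace.comap (fun w : EuclideanSpace ℝ (Latent nc) =>
        censor c (w (Sum.inr ()))) inferInstance)
        (ProbabilityTheory.cond ν (censoredRegion nc c)) (fun w => w k))
      (condExp (MeasurableSpace.comap (fun w : EuclideanSpace ℝ (Latent nc) =>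
        censor c (w (Sum.inr ()))) inferInstance)
        (ProbabilityTheory.cond ν (censoredRegion nc c)) (fun w => w l))
      (ProbabilityTheory.cond ν (censoredRegion nc c)) =
    Hc no ν c (Sum.inr k) (Sum.inr l) := by
  have hs : ν (censoredRegion nc c) ≠ 0 := fun h =>
    h₁ (measure_mono_null (fun w hw => hw.1) h)
  have hη : IsProbabilityMeasure (ProbabilityTheory.cond ν (censoredRegion nc c)) :=
    cond_isProbabilityMeasure hs
  have hτ₁ : IsProbabilityMeasure (truncAbove ν c) := cond_isProbabilityMeasure h₁
  have hτ₀ : IsProbabilityMeasure (truncBelow ν c) := cond_isProbabilityMeasure h₀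
  -- Splitting the censored region at `Y'_{n+1} = c` puts the law in the form required by
  -- `covariance_condExp_censor`, with weights `λ` and `1 - λ`.
  have hmix : ProbabilityTheory.cond ν (censoredRegion nc c) =
      (ν (regionAbove nc c) / ν (censoredRegion nc c)) • truncAbove ν c +
        (ν (regionBelow nc c) / ν (censoredRegion nc c)) • truncBelow ν c :=
    cond_eq_add_of_disjoint (measurableSet_regionBelow c) (disjoint_regionAbove_regionBelow c)
      (censoredRegion_eq_union c) h₁ h₀
  rw [hmix] at hη ⊢
  have a₁ : ∀ᵐ w ∂(truncAbove ν c), c ≤ w (Sum.inr ()) :=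
    (ae_cond_mem (measurableSet_regionAbove c)).mono fun w hw => hw.2
  have a₀ : ∀ᵐ w ∂(truncBelow ν c), w (Sum.inr ()) < c :=
    (ae_cond_mem (measurableSet_regionBelow c)).mono fun w hw => hw.2
  rw [covariance_condExp_censor (ENNReal.div_ne_top (measure_ne_top _ _) hs)
    (ENNReal.div_ne_top (measure_ne_top _ _) hs) (toReal_below_div h₁) (by fun_prop) a₁ a₀
    (memLp_cond h₁ (hν k)) (memLp_cond h₀ (hν k)) (memLp_cond h₁ (hν l)) (memLp_cond h₀ (hν l)),
    toReal_above_div, integral_condCov_truncBelow no hν h₀]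
  simp [Hc, sigmaOne, meanGap, Matrix.vecMulVec_apply]

omit [IsProbabilityMeasure ν] in
lemma Hc_inl_left (i : Fin no) (r : Run no nc) : Hc no ν c (Sum.inl i) r = 0 := by
  rcases r with r | r <;> simp [Hc, sigmaOne, sigmaHat, meanGap, Matrix.vecMulVec_apply]

omit [IsProbabilityMeasure ν] in
lemma Hc_inl_right (i : Fin no) (r : Run no nc) : Hc no ν c r (Sum.inl i) = 0 := by
  rcases r with r | r <;> simp [Hc, sigmaOne, sigmaHat, meanGap, Matrix.vecMulVec_apply]

omit [IsProbabilityMeasure ν] in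
lemma dotProduct_Hc_mulVec (β : Run no nc → ℝ) :
    β ⬝ᵥ (Hc no ν c *ᵥ β) =
      ∑ k, ∑ l, β (Sum.inr k) * (β (Sum.inr l) * Hc no ν c (Sum.inr k) (Sum.inr l)) := by
  simp only [dotProduct, Matrix.mulVec, Fintype.sum_sum_type (α₁ := Fin no), Hc_inl_left,
    Hc_inl_right, zero_mul, Finset.sum_const_zero, mul_zero, zero_add, Finset.mul_sum]
  exact Finset.sum_congr rfl fun i _ => Finset.sum_congr rfl fun j _ => by ring

end Truncation

/-! ### Reduction of the expected conditional variance to the latent responses. -/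

section Reduction

variable {nc : ℕ} {Ω : Type*} {m m₀ : MeasurableSpace Ω} {Q : Measure Ω} [IsProbabilityMeasure Q]
  {W : Ω → EuclideanSpace ℝ (Latent nc)} {ν : Measure (EuclideanSpace ℝ (Latent nc))}
  [IsProbabilityMeasure ν] {c : ℝ} {X r : Ω → ℝ} {b : Latent nc → ℝ}

lemma variance_sum_mul_add_const {ι : Type*} [Fintype ι] {Z : ι → Ω → ℝ}
    (hZ : ∀ k, MemLp (Z k) 2 Q) (b : ι → ℝ) (d : ℝ) :
    variance (fun ω => (∑ k, b k * Z k ω) + d) Q =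
      ∑ k, ∑ l, b k * (b l * covariance (Z k) (Z l) Q) := by
  have hm : ∀ k, MemLp (fun ω => b k * Z k ω) 2 Q := fun k => (hZ k).const_mul _
  have hs : MemLp (fun ω => ∑ k, b k * Z k ω) 2 Q := memLp_finsetSum _ fun k _ => hm k
  rw [variance_add_const hs.1, ← covariance_self hs.aemeasurable, covariance_fun_sum_fun_sum hm hm]
  simp_rw [covariance_const_mul_left, covariance_const_mul_right]

/-- Expected conditional variance, given the censored new response, of a variable that is linear in
the latent responses up to an independent remainder. -/
theorem integral_condVar_censor (no : ℕ) (hW : Measurable W)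
    (hm : m = MeasurableSpace.comap (fun ω => censor c (W ω (Sum.inr ()))) inferInstance)
    (hQ : Q.map W = ProbabilityTheory.cond ν (censoredRegion nc c))
    (hν : ∀ l, MemLp (fun w => w l) 2 ν) (h₁ : ν (regionAbove nc c) ≠ 0)
    (h₀ : ν (regionBelow nc c) ≠ 0) (hX : X = fun ω => (∑ l, b l * W ω l) + r ω)
    (hr : Measurable r) (hr2 : MemLp r 2 Q) (hind : IndepFun r W Q) :
    ∫ ω, condVar m X Q ω ∂Q =
    variance X Q - ∑ k, ∑ l, b k * (b l * Hc no ν c (Sum.inr k) (Sum.inr l)) := by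
  have hs : ν (censoredRegion nc c) ≠ 0 := fun h =>
    h₁ (measure_mono_null (fun w hw => hw.1) h)
  have hf : Measurable fun w : EuclideanSpace ℝ (Latent nc) => censor c (w (Sum.inr ())) :=
    (measurable_censor c).comp (by fun_prop)
  have hle : m ≤ m₀ := hm ▸ (hf.comp hW).comap_le
  have hη : ∀ l, MemLp (fun w => w l) 2 (Q.map W) := fun l => by
    rw [hQ]
    exact memLp_cond hs (hν l)
  have hWl : ∀ l, MemLp (fun ω => W ω l) 2 Q := fun l => (hη l).comp_of_map hW.aemeasurable
  have hWm : ∀ l, MemLp (fun ω => b l * W ω l) 2 Q := fun l => (hWl l).const_mul _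
  have hX2 : MemLp X 2 Q := by
    rw [hX]
    exact (memLp_finsetSum _ fun l _ => hWm l).add hr2
  -- The conditioning σ-algebra is pulled back along `W`; this permits `condExp_map` and also makes
  -- it independent of `r`.
  have hmcomap : m = (MeasurableSpace.comap (fun w : EuclideanSpace ℝ (Latent nc) =>
      censor c (w (Sum.inr ()))) inferInstance).comap W := by
    rw [hm, MeasurableSpace.comap_comp]
    rfl
  have hce : ∀ l, condExp m Q (fun ω => W ω l) =ᵐ[Q]
      condExp (MeasurableSpace.comap (fun w : EuclideanSpace ℝ (Latent nc) =>
      censor c (w (Sum.inr ()))) inferInstance) (Q.map W) (fun w => w l) ∘ W := fun l => by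
    rw [hmcomap]
    exact condExp_map hW hf.comap_le ((hη l).integrable one_le_two)
  have hcov : ∀ k l, covariance (condExp m Q fun ω => W ω k) (condExp m Q fun ω => W ω l) Q =
      Hc no ν c (Sum.inr k) (Sum.inr l) := fun k l => by
    rw [covariance_congr_ae (hce k) (hce l), ← covariance_map
      (stronglyMeasurable_condExp.mono hf.comap_le).aestronglyMeasurable
      (stronglyMeasurable_condExp.mono hf.comap_le).aestronglyMeasurable hW.aemeasurable, hQ]
    exact covariance_condExp_eq_Hc no hν h₁ h₀ k l
  have hrc : condExp m Q r =ᵐ[Q] fun _ => ∫ ω, r ω ∂Q := by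
    refine condExp_indep_eq hr.comap_le hle (comap_measurable r).stronglyMeasurable ?_
    exact indep_of_indep_of_le_right hind (hmcomap ▸ MeasurableSpace.comap_mono hf.comap_le)
  have hXc : condExp m Q X =ᵐ[Q]
      fun ω => (∑ l, b l * condExp m Q (fun ω => W ω l) ω) + ∫ ω, r ω ∂Q := by
    have e1 : condExp m Q X =ᵐ[Q] condExp m Q (fun ω => ∑ l, b l * W ω l) + condExp m Q r := by
      rw [hX]
      exact condExp_add ((memLp_finsetSum _ fun l _ => hWm l).integrable one_le_two)
        (hr2.integrable one_le_two) m
    have e2 : condExp m Q (fun ω => ∑ l, b l * W ω l) =ᵐ[Q]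
        ∑ l, condExp m Q (fun ω => b l * W ω l) := by
      have : (fun ω => ∑ l, b l * W ω l) = ∑ l, fun ω => b l * W ω l := by
        ext ω
        simp
      rw [this]
      exact condExp_finsetSum (fun l _ => (hWm l).integrable one_le_two) m
    have e3 : ∀ᵐ ω ∂Q, ∀ l, condExp m Q (fun ω => b l * W ω l) ω =
        b l * condExp m Q (fun ω => W ω l) ω :=
      ae_all_iff.2 fun l => condExp_smul (b l) (fun ω => W ω l) m
    filter_upwards [e1, e2, e3, hrc] with ω h1 h2 h3 h4
    rw [h1, Pi.add_apply, h2, h4, Finset.sum_apply]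
    simp_rw [h3]
  -- Law of total variance; the constant conditional mean of `r` adds nothing to the variance of the
  -- conditional expectation of `X`.
  have htot := integral_condVar_add_variance_condExp hle hX2
  rw [variance_congr hXc, variance_sum_mul_add_const (fun l => (hWl l).condExp one_le_two)] at htot
  simp_rw [hcov] at htot
  linarith

lemma variance_sum_mul_add_indep (hW : Measurable W) (hWl : ∀ l, MemLp (fun ω => W ω l) 2 Q)
    (hr2 : MemLp r 2 Q) (hind : IndepFun r W Q) (b : Latent nc → ℝ) :
    variance (fun ω => (∑ l, b l * W ω l) + r ω) Q =
      (∑ k, ∑ l, b k * (b l * covariance (fun w => w k) (fun w => w l) (Q.map W))) +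
        variance r Q := by
  have hs : MemLp (fun ω => ∑ k, b k * W ω k) 2 Q :=
    memLp_finsetSum _ fun k _ => (hWl k).const_mul _
  have hi : IndepFun (fun ω => ∑ k, b k * W ω k) r Q :=
    (hind.comp (φ := id) (ψ := fun w : EuclideanSpace ℝ (Latent nc) => ∑ k, b k * w k)
      measurable_id (by fun_prop)).symm
  have h := variance_sum_mul_add_const hWl b 0
  simp only [add_zero] at h
  refine (hi.variance_add hs hr2).trans ?_
  rw [h]
  congr 1
  refine Finset.sum_congr rfl fun k _ => Finset.sum_congr rfl fun l _ => ?_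
  rw [covariance_map_fun (Measurable.aestronglyMeasurable (by fun_prop))
    (Measurable.aestronglyMeasurable (by fun_prop)) hW.aemeasurable]

end Reduction

/-! ### The posterior given the censored data and the criterion at a point. -/

section PosteriorData

variable {p no nc : ℕ} {Ω : Type*} [MeasurableSpace Ω] {P : Measure Ω}
  {ξ : Cube p → Ω → ℝ} {ε : Run no nc → Ω → ℝ} {μ σξ : ℝ} {R : Cube p → Cube p → ℝ} {σε : ℝ≥0}

/-- The vector of the latent responses. -/
noncomputable def latentResponse (ξ : Cube p → Ω → ℝ) (ε : Run no nc → Ω → ℝ)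
    (x : Run no nc → Cube p) (ω : Ω) : EuclideanSpace ℝ (Latent nc) :=
  WithLp.toLp 2 fun l => response ξ ε x (Sum.inr l) ω

lemma IsModel.measurable_latentResponse (h : IsModel P ξ ε μ σξ R σε) (x : Run no nc → Cube p) :
    Measurable (latentResponse ξ ε x) := by
  have := h.measurable_response x
  unfold latentResponse
  fun_prop

/-- The remainder of `ξ z` that is independent of the latent responses given the observed ones. -/
noncomputable def remainder (β : Run no nc → ℝ) (ξ : Cube p → Ω → ℝ) (ε : Run no nc → Ω → ℝ)
    (x : Run no nc → Cube p) (z : Cube p) (ω : Ω) : ℝ :=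
  ξ z ω - ∑ l, β (Sum.inr l) * response ξ ε x (Sum.inr l) ω

lemma IsModel.measurable_remainder (h : IsModel P ξ ε μ σξ R σε) (β : Run no nc → ℝ)
    (x : Run no nc → Cube p) (z : Cube p) : Measurable (remainder β ξ ε x z) :=
  (h.measurable_process z).sub
    (Finset.measurable_sum _ fun _ _ => (h.measurable_response x _).const_mul _)

lemma IsModel.map_posteriorObs_latentResponse (h : IsModel P ξ ε μ σξ R σε) (hσε : 0 < σε)
    (x : Run no nc → Cube p) (yo : Fin no → ℝ) :
    (posteriorObs P ξ σε (fun i => x (Sum.inl i)) yo).map (latentResponse ξ ε x) =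
      latentLaw (covMatrix σξ R σε x) μ yo := by
  have hP := h.isProbabilityMeasure
  -- The point `fun _ => 0` is arbitrary, since only the first marginal is kept.
  have key := congrArg (Measure.map Prod.fst) (h.map_posteriorObs_latent hσε x yo (fun _ => 0) rfl)
  have hm := (h.measurable_latentResponse x).prodMk (h.measurable_remainder
    ((covMatrix σξ R σε x)⁻¹ *ᵥ crossCov σξ R x fun _ => 0) x fun _ => 0)
  have hs : IsProbabilityMeasure (P.map fun ω =>
      (∑ i, ((covMatrix σξ R σε x)⁻¹ *ᵥ crossCov σξ R x fun _ => 0) (Sum.inl i) * yo i) +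
        processResidual ((covMatrix σξ R σε x)⁻¹ *ᵥ crossCov σξ R x fun _ => 0) ξ ε x
          (fun _ => 0) ω) :=
    Measure.isProbabilityMeasure_map
      ((h.memLp_processResidual x _ _).aemeasurable.const_add _)
  rw [← Measure.fst, ← Measure.fst, Measure.fst_prod] at key
  refine Eq.trans ?_ key
  rw [Measure.fst]
  exact (Measure.map_map measurable_fst hm).symm

lemma posteriorData_eq_cond (x : Run no nc → Cube p) (c : ℝ) (yo : Fin no → ℝ) :
    posteriorData P ξ ε σε x c yo =
      ProbabilityTheory.cond (posteriorObs P ξ σε (fun i => x (Sum.inl i)) yo)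
        (latentResponse ξ ε x ⁻¹' censoredRegion nc c) := rfl

/-- If the region were null for the posterior it would be null for the prior, which charges the box
with free observed coordinates, censored coordinates in `[c, ∞)` and new coordinate in `J`. -/
lemma IsModel.latentLaw_region_ne_zero (h : IsModel P ξ ε μ σξ R σε) (hσε : 0 < σε)
    (x : Run no nc → Cube p) (c : ℝ) (yo : Fin no → ℝ) {J : Set ℝ} (hJ : MeasurableSet J)
    (hJ0 : volume J ≠ 0) {B : Set (EuclideanSpace ℝ (Latent nc))} (hB : MeasurableSet B)
    (hBJ : ∀ w : EuclideanSpace ℝ (Latent nc),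
      (∀ j : Fin nc, c ≤ w (Sum.inl j)) → w (Sum.inr ()) ∈ J → w ∈ B) :
    latentLaw (covMatrix σξ R σε x) μ yo B ≠ 0 := by
  have hP := h.isProbabilityMeasure
  rw [← h.map_posteriorObs_latentResponse hσε x yo,
    Measure.map_apply (h.measurable_latentResponse x) hB]
  intro h0
  refine h.measure_response_mem_ne_zero hσε x
    (I := Sum.elim (fun _ => Set.univ) (Sum.elim (fun _ => Set.Ici c) fun _ => J)) ?_ ?_
    (measure_mono_null ?_
      (absolutelyContinuous_posteriorObs h.measurable_process hσε yo h0))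
  · rintro (i | j | u)
    exacts [MeasurableSet.univ, measurableSet_Ici, hJ]
  · rintro (i | j | u)
    · simp
    · simp
    · exact hJ0
  · intro ω hω
    exact hBJ _ (fun j => hω (Sum.inr (Sum.inl j))) (hω (Sum.inr (Sum.inr ())))

variable (x : Run no nc → Cube p) (c : ℝ) (yo : Fin no → ℝ)

lemma IsModel.regionAbove_ne_zero (h : IsModel P ξ ε μ σξ R σε) (hσε : 0 < σε) :
    latentLaw (covMatrix σξ R σε x) μ yo (regionAbove nc c) ≠ 0 :=
  h.latentLaw_region_ne_zero hσε x c yo measurableSet_Ici (by simp) (measurableSet_regionAbove c)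
    fun _ h1 h2 => ⟨h1, h2⟩

lemma IsModel.regionBelow_ne_zero (h : IsModel P ξ ε μ σξ R σε) (hσε : 0 < σε) :
    latentLaw (covMatrix σξ R σε x) μ yo (regionBelow nc c) ≠ 0 :=
  h.latentLaw_region_ne_zero hσε x c yo measurableSet_Iio (by simp) (measurableSet_regionBelow c)
    fun _ h1 h2 => ⟨h1, h2⟩

lemma IsModel.censoredRegion_ne_zero (h : IsModel P ξ ε μ σξ R σε) (hσε : 0 < σε) :
    latentLaw (covMatrix σξ R σε x) μ yo (censoredRegion nc c) ≠ 0 := fun h0 =>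
  h.regionAbove_ne_zero x c yo hσε (measure_mono_null (fun _ hw => hw.1) h0)

lemma isProbabilityMeasure_latentLaw (Γ : Matrix (Run no nc) (Run no nc) ℝ) :
    IsProbabilityMeasure (latentLaw Γ μ yo) := by
  unfold latentLaw
  infer_instance

lemma memLp_eval_latentLaw (Γ : Matrix (Run no nc) (Run no nc) ℝ) (l : Latent nc) :
    MemLp (fun w => w l) 2 (latentLaw Γ μ yo) := by
  have hG : IsGaussian (latentLaw Γ μ yo) := by
    unfold latentLaw
    infer_instance
  exact (IsGaussian.hasGaussianLaw_id.map_fun (EuclideanSpace.proj (𝕜 := ℝ) l)).memLp_two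

lemma IsModel.isProbabilityMeasure_posteriorData (h : IsModel P ξ ε μ σξ R σε) (hσε : 0 < σε) :
    IsProbabilityMeasure (posteriorData P ξ ε σε x c yo) := by
  have hP := h.isProbabilityMeasure
  have := isProbabilityMeasure_posteriorObs (P := P) (xo := fun i => x (Sum.inl i))
    h.measurable_process hσε yo
  rw [posteriorData_eq_cond]
  refine cond_isProbabilityMeasure ?_
  rw [← Measure.map_apply (h.measurable_latentResponse x) (measurableSet_censoredRegion c),
    h.map_posteriorObs_latentResponse hσε x yo]
  exact h.censoredRegion_ne_zero x c yo hσε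

/-- Under the posterior given the data, the latent responses follow the truncated law and are
independent of the remainder. -/
lemma IsModel.map_posteriorData (h : IsModel P ξ ε μ σξ R σε) (hσε : 0 < σε) (z : Cube p)
    {β : Run no nc → ℝ} (hβ : β = (covMatrix σξ R σε x)⁻¹ *ᵥ crossCov σξ R x z) :
    (posteriorData P ξ ε σε x c yo).map
      (fun ω => (latentResponse ξ ε x ω, remainder β ξ ε x z ω)) =
    (ProbabilityTheory.cond (latentLaw (covMatrix σξ R σε x) μ yo) (censoredRegion nc c)).prod
      (P.map fun ω => (∑ i, β (Sum.inl i) * yo i) + processResidual β ξ ε x z ω) := by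
  have hP := h.isProbabilityMeasure
  have hρ : IsProbabilityMeasure
      (P.map fun ω => (∑ i, β (Sum.inl i) * yo i) + processResidual β ξ ε x z ω) :=
    Measure.isProbabilityMeasure_map ((h.memLp_processResidual x _ _).aemeasurable.const_add _)
  have hν := isProbabilityMeasure_latentLaw (μ := μ) yo (covMatrix σξ R σε x)
  have hm := (h.measurable_latentResponse x).prodMk (h.measurable_remainder β x z)
  -- The censoring event is a cylinder over the latent coordinates, so the product law stays a
  -- product.
  rw [← cond_prod_univ, ← h.map_posteriorObs_latent hσε x yo z hβ]
  exact map_cond_preimage (posteriorObs P ξ σε (fun i => x (Sum.inl i)) yo) hm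
    ((measurableSet_censoredRegion c).prod MeasurableSet.univ) ▸ by
      congr 1
      rw [posteriorData_eq_cond]
      congr 1
      ext ω
      simp

lemma IsModel.map_latentResponse_posteriorData (h : IsModel P ξ ε μ σξ R σε) (hσε : 0 < σε) :
    (posteriorData P ξ ε σε x c yo).map (latentResponse ξ ε x) =
      ProbabilityTheory.cond (latentLaw (covMatrix σξ R σε x) μ yo) (censoredRegion nc c) := by
  rw [posteriorData_eq_cond, map_cond_preimage _ (h.measurable_latentResponse x)
    (measurableSet_censoredRegion c), h.map_posteriorObs_latentResponse hσε x yo]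

lemma IsModel.map_remainder_posteriorData (h : IsModel P ξ ε μ σξ R σε) (hσε : 0 < σε) (z : Cube p)
    {β : Run no nc → ℝ} (hβ : β = (covMatrix σξ R σε x)⁻¹ *ᵥ crossCov σξ R x z) :
    (posteriorData P ξ ε σε x c yo).map (remainder β ξ ε x z) =
      P.map fun ω => (∑ i, β (Sum.inl i) * yo i) + processResidual β ξ ε x z ω := by
  have hP := h.isProbabilityMeasure
  have hρ : IsProbabilityMeasure
      (P.map fun ω => (∑ i, β (Sum.inl i) * yo i) + processResidual β ξ ε x z ω) :=
    Measure.isProbabilityMeasure_map ((h.memLp_processResidual x _ _).aemeasurable.const_add _)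
  have hν := isProbabilityMeasure_latentLaw (μ := μ) yo (covMatrix σξ R σε x)
  have hη : IsProbabilityMeasure (ProbabilityTheory.cond (latentLaw (covMatrix σξ R σε x) μ yo)
      (censoredRegion nc c)) := cond_isProbabilityMeasure (h.censoredRegion_ne_zero x c yo hσε)
  have key := congrArg Measure.snd (h.map_posteriorData x c yo hσε z hβ)
  rw [Measure.snd_prod, Measure.snd, Measure.map_map measurable_snd
    ((h.measurable_latentResponse x).prodMk (h.measurable_remainder β x z))] at key
  exact key

lemma IsModel.indepFun_posteriorData (h : IsModel P ξ ε μ σξ R σε) (hσε : 0 < σε) (z : Cube p)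
    {β : Run no nc → ℝ} (hβ : β = (covMatrix σξ R σε x)⁻¹ *ᵥ crossCov σξ R x z) :
    IndepFun (remainder β ξ ε x z) (latentResponse ξ ε x) (posteriorData P ξ ε σε x c yo) := by
  have hQ := h.isProbabilityMeasure_posteriorData x c yo hσε
  refine IndepFun.symm ?_
  rw [indepFun_iff_map_prod_eq_prod_map_map (h.measurable_latentResponse x).aemeasurable
    (h.measurable_remainder β x z).aemeasurable, h.map_posteriorData x c yo hσε z hβ,
    h.map_latentResponse_posteriorData x c yo hσε, h.map_remainder_posteriorData x c yo hσε z hβ]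

/-- Moments of the remainder under the posterior can thus be computed under the prior. -/
lemma IsModel.identDistrib_remainder (h : IsModel P ξ ε μ σξ R σε) (hσε : 0 < σε) (z : Cube p)
    {β : Run no nc → ℝ} (hβ : β = (covMatrix σξ R σε x)⁻¹ *ᵥ crossCov σξ R x z) :
    IdentDistrib (remainder β ξ ε x z)
      (fun ω => (∑ i, β (Sum.inl i) * yo i) + processResidual β ξ ε x z ω)
      (posteriorData P ξ ε σε x c yo) P where
  aemeasurable_fst := (h.measurable_remainder β x z).aemeasurable
  aemeasurable_snd := (h.memLp_processResidual x β z).aemeasurable.const_add _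
  map_eq := h.map_remainder_posteriorData x c yo hσε z hβ

lemma IsModel.memLp_remainder (h : IsModel P ξ ε μ σξ R σε) (hσε : 0 < σε) (z : Cube p)
    {β : Run no nc → ℝ} (hβ : β = (covMatrix σξ R σε x)⁻¹ *ᵥ crossCov σξ R x z) :
    MemLp (remainder β ξ ε x z) 2 (posteriorData P ξ ε σε x c yo) := by
  have hP := h.isProbabilityMeasure
  refine (h.identDistrib_remainder x c yo hσε z hβ).memLp_iff.2 ?_
  exact (memLp_const (∑ i, β (Sum.inl i) * yo i)).add (h.memLp_processResidual x β z)

lemma IsModel.variance_remainder (h : IsModel P ξ ε μ σξ R σε) (hσε : 0 < σε) (z : Cube p)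
    {β : Run no nc → ℝ} (hβ : β = (covMatrix σξ R σε x)⁻¹ *ᵥ crossCov σξ R x z) :
    variance (remainder β ξ ε x z) (posteriorData P ξ ε σε x c yo) =
      σξ ^ 2 - crossCov σξ R x z ⬝ᵥ β := by
  have hP := h.isProbabilityMeasure
  rw [(h.identDistrib_remainder x c yo hσε z hβ).variance_eq,
    variance_const_add (h.memLp_processResidual x β z).1, hβ, h.variance_processResidual hσε x z]

omit [MeasurableSpace Ω] in
lemma process_eq_sum_add_remainder (β : Run no nc → ℝ) (z : Cube p) :
    ξ z = fun ω => (∑ l, β (Sum.inr l) * latentResponse ξ ε x ω l) + remainder β ξ ε x z ω := by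
  funext ω
  simp [remainder, latentResponse]

lemma IsModel.memLp_latentResponse (h : IsModel P ξ ε μ σξ R σε) (hσε : 0 < σε) (l : Latent nc) :
    MemLp (fun ω => latentResponse ξ ε x ω l) 2 (posteriorData P ξ ε σε x c yo) := by
  have hm : MemLp (fun w => w l) 2
      ((posteriorData P ξ ε σε x c yo).map (latentResponse ξ ε x)) := by
    rw [h.map_latentResponse_posteriorData x c yo hσε]
    exact memLp_cond (h.censoredRegion_ne_zero x c yo hσε) (memLp_eval_latentLaw yo _ l)
  exact hm.comp_of_map (h.measurable_latentResponse x).aemeasurable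

lemma IsModel.memLp_process_posteriorData (h : IsModel P ξ ε μ σξ R σε) (hσε : 0 < σε)
    (z : Cube p) : MemLp (ξ z) 2 (posteriorData P ξ ε σε x c yo) := by
  rw [process_eq_sum_add_remainder (ξ := ξ) (ε := ε) x ((covMatrix σξ R σε x)⁻¹ *ᵥ crossCov σξ R x z) z]
  exact (memLp_finsetSum _ fun l _ => (h.memLp_latentResponse x c yo hσε l).const_mul _).add
    (h.memLp_remainder x c yo hσε z rfl)

/-- The formula depends on `z` only through `crossCov σξ R x z`, which is what the integrability of
the criterion rests on. -/
lemma IsModel.variance_process_posteriorData (h : IsModel P ξ ε μ σξ R σε) (hσε : 0 < σε)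
    (z : Cube p) {β : Run no nc → ℝ} (hβ : β = (covMatrix σξ R σε x)⁻¹ *ᵥ crossCov σξ R x z) :
    variance (ξ z) (posteriorData P ξ ε σε x c yo) =
      (∑ k, ∑ l, β (Sum.inr k) * (β (Sum.inr l) * covariance (fun w => w k) (fun w => w l)
        (ProbabilityTheory.cond (latentLaw (covMatrix σξ R σε x) μ yo) (censoredRegion nc c)))) +
      (σξ ^ 2 - crossCov σξ R x z ⬝ᵥ β) := by
  have hQ := h.isProbabilityMeasure_posteriorData x c yo hσε
  rw [process_eq_sum_add_remainder (ξ := ξ) (ε := ε) x β z, variance_sum_mul_add_indep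
    (h.measurable_latentResponse x) (h.memLp_latentResponse x c yo hσε)
    (h.memLp_remainder x c yo hσε z hβ) (h.indepFun_posteriorData x c yo hσε z hβ)
    (fun l => β (Sum.inr l)), h.variance_remainder x c yo hσε z hβ,
    h.map_latentResponse_posteriorData x c yo hσε]

theorem IsModel.cmse_eq (h : IsModel P ξ ε μ σξ R σε) (hσε : 0 < σε)
    (z : Cube p) {β : Run no nc → ℝ} (hβ : β = (covMatrix σξ R σε x)⁻¹ *ᵥ crossCov σξ R x z) :
    cmse (posteriorData P ξ ε σε x c yo) ξ ε x c z =
      variance (ξ z) (posteriorData P ξ ε σε x c yo) -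
        β ⬝ᵥ (Hc no (latentLaw (covMatrix σξ R σε x) μ yo) c *ᵥ β) := by
  have hQ := h.isProbabilityMeasure_posteriorData x c yo hσε
  have hν := isProbabilityMeasure_latentLaw (μ := μ) yo (covMatrix σξ R σε x)
  rw [dotProduct_Hc_mulVec]
  exact integral_condVar_censor no (h.measurable_latentResponse x) rfl
    (h.map_latentResponse_posteriorData x c yo hσε) (memLp_eval_latentLaw yo _)
    (h.regionAbove_ne_zero x c yo hσε) (h.regionBelow_ne_zero x c yo hσε)
    (process_eq_sum_add_remainder x β z) (h.measurable_remainder β x z)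
    (h.memLp_remainder x c yo hσε z hβ) (h.indepFun_posteriorData x c yo hσε z hβ)

/-- Both the sum and the difference of two process values have nonnegative variance, and each value
has variance `σξ ^ 2`. -/
lemma IsModel.abs_crossCov_le (h : IsModel P ξ ε μ σξ R σε) (z : Cube p) (i : Run no nc) :
    |crossCov σξ R x z i| ≤ σξ ^ 2 := by
  have hP := h.isProbabilityMeasure
  have hX := h.memLp_process (x i)
  have hZ := h.memLp_process z
  have hv : ∀ y, variance (ξ y) P = σξ ^ 2 := fun y => by
    rw [← covariance_self (h.measurable_process y).aemeasurable, h.cov_process, h.corr_self,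
      mul_one]
  have h1 := variance_nonneg (ξ (x i) + ξ z) P
  have h2 := variance_nonneg (ξ (x i) - ξ z) P
  rw [variance_add hX hZ, hv, hv, h.cov_process] at h1
  rw [variance_sub hX hZ, hv, hv, h.cov_process] at h2
  rw [crossCov, abs_le]
  constructor <;> linarith

lemma IsModel.integrable_cmse (h : IsModel P ξ ε μ σξ R σε) (hσε : 0 < σε)
    (hR : ∀ z, Measurable (R z)) :
    Integrable (cmse (posteriorData P ξ ε σε x c yo) ξ ε x c) volume := by
  set ν := latentLaw (covMatrix σξ R σε x) μ yo with hν
  -- The integrand is this quadratic polynomial evaluated at `crossCov σξ R x z`, which stays in a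
  -- compact box; hence it is bounded and measurable on a space of finite measure.
  let f : (Run no nc → ℝ) → ℝ := fun g =>
    (∑ k, ∑ l, ((covMatrix σξ R σε x)⁻¹ *ᵥ g) (Sum.inr k) *
      (((covMatrix σξ R σε x)⁻¹ *ᵥ g) (Sum.inr l) * covariance (fun w => w k) (fun w => w l)
        (ProbabilityTheory.cond ν (censoredRegion nc c)))) +
      (σξ ^ 2 - g ⬝ᵥ ((covMatrix σξ R σε x)⁻¹ *ᵥ g)) -
      ((covMatrix σξ R σε x)⁻¹ *ᵥ g) ⬝ᵥ (Hc no ν c *ᵥ ((covMatrix σξ R σε x)⁻¹ *ᵥ g))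
  have hf : Continuous f := by
    simp only [f, dotProduct, Matrix.mulVec]
    fun_prop
  have he : cmse (posteriorData P ξ ε σε x c yo) ξ ε x c = fun z => f (crossCov σξ R x z) := by
    funext z
    rw [h.cmse_eq x c yo hσε z rfl, h.variance_process_posteriorData x c yo hσε z rfl]
  have hγ : Measurable fun z => crossCov σξ R x z :=
    measurable_pi_lambda _ fun i => (hR (x i)).const_mul _
  rw [he]
  obtain ⟨C, hC⟩ := (isCompact_Icc (a := fun _ : Run no nc => -σξ ^ 2)
    (b := fun _ => σξ ^ 2)).exists_bound_of_continuousOn hf.continuousOn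
  refine Integrable.of_bound (hf.measurable.comp hγ).aestronglyMeasurable C
    (ae_of_all _ fun z => hC _ ⟨fun i => ?_, fun i => ?_⟩)
  · exact (abs_le.1 (h.abs_crossCov_le x z i)).1
  · exact (abs_le.1 (h.abs_crossCov_le x z i)).2

end PosteriorData

/-- With `A = Γ⁻¹` and `v = γ z`, symmetry of `A` identifies the quadratic form of the theorem with
the one in `β` from `IsModel.cmse_eq`. -/
lemma dotProduct_conj_mulVec {ι : Type*} [Fintype ι] {A H : Matrix ι ι ℝ} (hA : A.IsHermitian)
    (v : ι → ℝ) : v ⬝ᵥ ((A * H * A) *ᵥ v) = (A *ᵥ v) ⬝ᵥ (H *ᵥ (A *ᵥ v)) := by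
  have hT : Aᵀ = A := by simpa [Matrix.IsHermitian, Matrix.conjTranspose_eq_transpose_of_trivial]
    using hA
  rw [← Matrix.mulVec_mulVec, ← Matrix.mulVec_mulVec, Matrix.dotProduct_mulVec,
    ← Matrix.mulVec_transpose, hT]

end CensoredGP

theorem proposition2 {p no nc : ℕ} {Ω : Type*} [MeasurableSpace Ω] (P : Measure Ω)
    (ξ : Cube p → Ω → ℝ) (ε : Run no nc → Ω → ℝ) (μ σξ : ℝ) (R : Cube p → Cube p → ℝ) (σε : ℝ≥0)
    (hσε : 0 < σε) (hmodel : IsModel P ξ ε μ σξ R σε) (hR : ∀ z, Measurable (R z))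
    (xo : Fin no → Cube p) (xc : Fin nc → Cube p) (xnext : Cube p)
    (c : ℝ) (yo : Fin no → ℝ) :
    let x : Run no nc → Cube p := design xo xc xnext
    let Q : Measure Ω := posteriorData P ξ ε σε x c yo
    let Γ : Matrix (Run no nc) (Run no nc) ℝ := covMatrix σξ R σε x
    let γ : Cube p → Run no nc → ℝ := crossCov σξ R x
    let ν : Measure (EuclideanSpace ℝ (Latent nc)) := latentLaw Γ μ yo
    let H : Matrix (Run no nc) (Run no nc) ℝ := Hc no ν c
    IsProbabilityMeasure Q ∧
    (∀ z, MemLp (ξ z) 2 Q) ∧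
    Γ.PosDef ∧
    (posteriorObs P ξ σε xo yo).map
      (fun ω => WithLp.toLp 2 fun l => response ξ ε x (Sum.inr l) ω) = ν ∧
    Integrable (cmse Q ξ ε x c) volume ∧
    icmse Q ξ ε x c = ∫ z, (variance (ξ z) Q - γ z ⬝ᵥ ((Γ⁻¹ * H * Γ⁻¹) *ᵥ γ z)) := by
  intro x Q Γ γ ν H
  have hcmse : ∀ z, cmse Q ξ ε x c z = variance (ξ z) Q - γ z ⬝ᵥ ((Γ⁻¹ * H * Γ⁻¹) *ᵥ γ z) :=
    fun z => by
      rw [dotProduct_conj_mulVec (hmodel.posDef_covMatrix hσε x).inv.isHermitian]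
      exact hmodel.cmse_eq x c yo hσε z rfl
  exact ⟨hmodel.isProbabilityMeasure_posteriorData x c yo hσε,
    hmodel.memLp_process_posteriorData x c yo hσε, hmodel.posDef_covMatrix hσε x,
    hmodel.map_posteriorObs_latentResponse hσε x yo, hmodel.integrable_cmse x c yo hσε hR,
    integral_congr_ae (ae_of_all _ hcmse)⟩
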